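/- Let $V$ be a finite-dimensional real vector space with a nondegenerate, symmetric, possibly indefinite bilinear form $\langle\,,\rangle$, and let $J:V\to V$ be a skewadjoint linear operator, i.e. $\langle Jx,y\rangle=-\langle x,Jy\rangle$ for all $x,y\in V$. Then $V$ is the direct sum of finitely many mutually orthogonal, $J$-invariant subspaces, on each of which $\langle\,,\rangle$ is nondegenerate and each of which has, for some $r\ge 1$, a basis of one of the following five types. All inner products of basis vectors that are not listed, and do not follow from listed ones by symmetry, vanish. 1. (Eigenvalues $\pm a\pm ib$ with $a,b>0$; dimension $4r$.) A basis $u_1,v_1,\dots,u_r,v_r,w_1,x_1,\dots,w_r,x_r$ with $$Ju_h=au_h-bv_h+u_{h+1},\quad Jv_h=bu_h+av_h+v_{h+1},\quad Jw_h=-aw_h+bx_h+w_{h+1},\quad Jx_h=-bw_h-ax_h+x_{h+1},$$ where $u_{r+1}=v_{r+1}=w_{r+1}=x_{r+1}=0$, and $\langle u_h,w_j\rangle=(-1)^{j-1}$, $\langle v_h,x_j\rangle=(-1)^{j}$ if $h+j=r+1$. 2. (Eigenvalues $\pm i\lambda$ with $\lambda>0$; dimension $2r$.) A basis $u_1,v_1,\dots,u_r,v_r$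 and a sign $\varepsilon\in\{1,-1\}$ with $$Ju_h=-\lambda v_h+u_{h+1},\qquad Jv_h=\lambda u_h+v_{h+1},\qquad u_{r+1}=v_{r+1}=0,$$ and, if $h+j=r+1$: $\langle u_h,u_j\rangle=\langle v_h,v_j\rangle=\varepsilon(-1)^j$ when $r$ is odd, and $\langle v_h,u_j\rangle=-\langle u_h,v_j\rangle=\varepsilon(-1)^j$ when $r$ is even. 3. (Eigenvalues $\pm\mu$ with $\mu>0$; dimension $2r$.) A basis $v_1,\dots,v_r,w_1,\dots,w_r$ with $Jv_h=\mu v_h+v_{h+1}$, $Jw_h=-\mu w_h+w_{h+1}$, $v_{r+1}=w_{r+1}=0$, and $\langle v_h,w_j\rangle=(-1)^{j-1}$ if $h+j=r+1$. 4. (Nilpotent, $r$ even; dimension $2r$.) A basis $v_1,\dots,v_r,w_1,\dots,w_r$ with $Jv_h=v_{h+1}$, $Jw_h=w_{h+1}$, $v_{r+1}=w_{r+1}=0$, and $\langle v_h,w_j\rangle=(-1)^{j-1}$ if $h+j=r+1$. 5. (Nilpotent, $r$ odd; dimension $r$.) A basis $v_1,\dots,v_r$ and a sign $\varepsilon\in\{1,-1\}$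 with $Jv_h=v_{h+1}$, $v_{r+1}=0$, and $\langle v_h,v_j\rangle=\varepsilon(-1)^{j-1}$ if $h+j=r+1$. Moreover, the sizes are bounded by the exponents in the minimal polynomial of $J$: for every subspace, the polynomial $$(t^2-2at+a^2+b^2)^r(t^2+2at+a^2+b^2)^r,\quad (t^2+\lambda^2)^r,\quad (t-\mu)^r(t+\mu)^r,\quad t^r,\quad t^r$$ belonging to types 1 to 5, respectively, divides the minimal polynomial of $J$ over $\mathbb R$. -/

import Mathlib

/-- The canonical blocks of a skewadjoint operator, with their parameters and size `r`. -/
inductive CanonicalBlock : Type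
  /-- eigenvalues `±a ± ib`, basis `u₁, v₁, …, u_r, v_r, w₁, x₁, …, w_r, x_r` -/
  | complex (a b : ℝ) (r : ℕ)
  /-- eigenvalues `±iλ` and a sign `ε = ±1`, basis `u₁, v₁, …, u_r, v_r` -/
  | imaginary (lam : ℝ) (r : ℕ) (ε : ℤˣ)
  /-- eigenvalues `±μ`, basis `v₁, …, v_r, w₁, …, w_r` -/
  | real (mu : ℝ) (r : ℕ)
  /-- nilpotent of even size, in a pair, basis `v₁, …, v_r, w₁, …, w_r` -/
  | nilpotentPair (r : ℕ)
  /-- nilpotent of odd size with a sign `ε = ±1`, basis `v₁, …, v_r` -/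
  | nilpotentSingle (r : ℕ) (ε : ℤˣ)

namespace CanonicalBlock

/-- The constraints on the parameters of a canonical block. -/
def Valid : CanonicalBlock → Prop
  | complex a b r => 0 < a ∧ 0 < b ∧ 1 ≤ r
  | imaginary lam r _ => 0 < lam ∧ 1 ≤ r
  | real mu r => 0 < mu ∧ 1 ≤ r
  | nilpotentPair r => Even r ∧ 1 ≤ r
  | nilpotentSingle r _ => Odd r

/-- The index set of the basis. In `Fin r × Fin 2` the second coordinate tells `u_h` from `v_h`
(respectively `w_h` from `x_h`); the two summands of a sum type are the two families. -/
def Idx : CanonicalBlock → Type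
  | complex _ _ r => (Fin r × Fin 2) ⊕ (Fin r × Fin 2)
  | imaginary _ r _ => Fin r × Fin 2
  | real _ r => Fin r ⊕ Fin r
  | nilpotentPair r => Fin r ⊕ Fin r
  | nilpotentSingle r _ => Fin r

instance instFintypeIdx : (c : CanonicalBlock) → Fintype c.Idx
  | complex _ _ r => inferInstanceAs (Fintype ((Fin r × Fin 2) ⊕ (Fin r × Fin 2)))
  | imaginary _ r _ => inferInstanceAs (Fintype (Fin r × Fin 2))
  | real _ r => inferInstanceAs (Fintype (Fin r ⊕ Fin r))
  | nilpotentPair r => inferInstanceAs (Fintype (Fin r ⊕ Fin r))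
  | nilpotentSingle r _ => inferInstanceAs (Fintype (Fin r))

instance instDecidableEqIdx : (c : CanonicalBlock) → DecidableEq c.Idx
  | complex _ _ r => inferInstanceAs (DecidableEq ((Fin r × Fin 2) ⊕ (Fin r × Fin 2)))
  | imaginary _ r _ => inferInstanceAs (DecidableEq (Fin r × Fin 2))
  | real _ r => inferInstanceAs (DecidableEq (Fin r ⊕ Fin r))
  | nilpotentPair r => inferInstanceAs (DecidableEq (Fin r ⊕ Fin r))
  | nilpotentSingle r _ => inferInstanceAs (DecidableEq (Fin r))

/-- The `r × r` lower Jordan block: `mu` on the diagonal, `1` just below it. -/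
def jordan (r : ℕ) (mu : ℝ) : Matrix (Fin r) (Fin r) ℝ :=
  Matrix.of fun i j => if i = j then mu else if i.val = j.val + 1 then 1 else 0

/-- The `2r × 2r` real Jordan block: copies of the `2 × 2` matrix `M` on the diagonal and of the
`2 × 2` identity matrix just below it. -/
def realJordan (r : ℕ) (M : Matrix (Fin 2) (Fin 2) ℝ) :
    Matrix (Fin r × Fin 2) (Fin r × Fin 2) ℝ :=
  Matrix.of fun p q =>
    if p.1 = q.1 then M p.2 q.2
    else if p.1.val = q.1.val + 1 ∧ p.2 = q.2 then 1 else 0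

/-- The antidiagonal matrix with entry `(-1)^(j-1)` at `(h, j)` if `h + j = r + 1`, where `h, j`
are counted from `1`, and zeros elsewhere. -/
def antidiag (r : ℕ) : Matrix (Fin r) (Fin r) ℝ :=
  Matrix.of fun h j => if h.val + j.val + 1 = r then (-1) ^ j.val else 0

/-- The matrix of the operator on a canonical block (its columns are the images of the basis). -/
def operatorMatrix : (c : CanonicalBlock) → Matrix c.Idx c.Idx ℝ
  | complex a b r =>
      Matrix.fromBlocks (realJordan r !![a, b; -b, a]) 0 0 (realJordan r !![-a, -b; b, -a])
  | imaginary lam r _ => realJordan r !![0, lam; -lam, 0]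
  | real mu r => Matrix.fromBlocks (jordan r mu) 0 0 (jordan r (-mu))
  | nilpotentPair r => Matrix.fromBlocks (jordan r 0) 0 0 (jordan r 0)
  | nilpotentSingle r _ => jordan r 0

/-- The Gram matrix of the basis of a canonical block. With `h, j` counted from `1`, the inner
products of basis vectors that do not vanish are the following, all for `h + j = r + 1`
(and those obtained from them by symmetry).
* `complex`: `⟨u_h, w_j⟩ = (-1)^(j-1)` and `⟨v_h, x_j⟩ = (-1)^j`.
* `imaginary`, `r` odd: `⟨u_h, u_j⟩ = ⟨v_h, v_j⟩ = ε (-1)^j`.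
* `imaginary`, `r` even: `⟨v_h, u_j⟩ = ε (-1)^j` and `⟨u_h, v_j⟩ = -ε (-1)^j`.
* `real`, `nilpotentPair`: `⟨v_h, w_j⟩ = (-1)^(j-1)`.
* `nilpotentSingle`: `⟨v_h, v_j⟩ = ε (-1)^(j-1)`. -/
def gramMatrix : (c : CanonicalBlock) → Matrix c.Idx c.Idx ℝ
  | complex _ _ r =>
      Matrix.fromBlocks 0 (Matrix.kronecker (antidiag r) !![1, 0; 0, -1])
        (Matrix.kronecker (antidiag r) !![1, 0; 0, -1]).transpose 0
  | imaginary _ r ε =>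
      (-((ε : ℤ) : ℝ)) •
        Matrix.kronecker (antidiag r) (if Odd r then !![1, 0; 0, 1] else !![0, -1; 1, 0])
  | real _ r => Matrix.fromBlocks 0 (antidiag r) (antidiag r).transpose 0
  | nilpotentPair r => Matrix.fromBlocks 0 (antidiag r) (antidiag r).transpose 0
  | nilpotentSingle r ε => ((ε : ℤ) : ℝ) • antidiag r

open Polynomial in
/-- The product of powers of irreducible polynomials that belongs to a canonical block. -/
noncomputable def poly : CanonicalBlock → ℝ[X]
  | complex a b r =>
      (X ^ 2 - C (2 * a) * X + C (a ^ 2 + b ^ 2)) ^ r *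
        (X ^ 2 + C (2 * a) * X + C (a ^ 2 + b ^ 2)) ^ r
  | imaginary lam r _ => (X ^ 2 + C (lam ^ 2)) ^ r
  | real mu r => (X - C mu) ^ r * (X + C mu) ^ r
  | nilpotentPair r => X ^ r
  | nilpotentSingle r _ => X ^ r

/-- The subspace `W` is `J`-invariant and has a basis with respect to which `J` and the inner
product are given by the two matrices of the canonical block `c`. -/
def IsCarriedBy {V : Type*} [AddCommGroup V] [Module ℝ V] (c : CanonicalBlock)
    (B : LinearMap.BilinForm ℝ V) (J : V →ₗ[ℝ] V) (W : Submodule ℝ V) : Prop :=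
  ∃ hW : ∀ x ∈ W, J x ∈ W, ∃ e : Module.Basis c.Idx ℝ W,
    LinearMap.toMatrix e e (J.restrict hW) = c.operatorMatrix ∧
      LinearMap.BilinForm.toMatrix e (B.restrict W) = c.gramMatrix

end CanonicalBlock

/-! It suffices to find one canonical block in every nonzero space: a block has an invertible Gram
matrix, so it spans a nondegenerate `J`-invariant subspace, whose orthogonal complement is again
nondegenerate and, as `J` is skew, invariant. Induction on the dimension does the rest
(`exists_orthogonal_decomposition_of_exists_block`).

For one block, write `J = S + N` with commuting skewadjoint `S` semisimple and `N` nilpotent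
(`exists_skew_isSemisimple_isNilpotent`). Take an irreducible real `p` with ker p(S) ≠ 0 and the
largest m with N^m ≠ 0 on that kernel. The adjoint of p(S) is p(-S), and semisimplicity makes ker
p(S) and ker p(-S) dual to each other (`exists_mem_ker_pairing`), so a chain x, Nx, …, N^m x has a
dual vector y in ker p(-S). If p(X) and p(-X) are coprime, both kernels are isotropic and the two
chains form a block of type 1 or 3.

Otherwise ker p(S) is itself nondegenerate. For eigenvalues ±iλ the operator P = λ⁻¹SN is
selfadjoint, and so is N² on ker S; a chain with ⟨P^m x, x⟩ ≠ 0 can be normalized to a sign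
(`exists_normalized_chain`), which gives types 2 and 5. On ker S with m odd, N^m is skew, so ⟨N^m x,
x⟩ = 0 always; a pair of dual chains is needed, made isotropic by successive corrections, and gives
type 4.

The divisibility claim follows because p(J)^m does not kill the chosen vector of ker p(S), while
p(J)^(m+1) does. -/

namespace CanonicalBlock

/-! ### Invertible Gram matrices and the span of a block -/

open Matrix

theorem antidiag_transpose_mul_self (r : ℕ) : (antidiag r)ᵀ * antidiag r = 1 := by
  ext i j
  rw [Matrix.mul_apply, Finset.sum_eq_single (Fin.rev i)]
  · simp only [transpose_apply, antidiag, of_apply, Fin.val_rev, Matrix.one_apply, Fin.ext_iff]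
    have hi := i.isLt
    have hj := j.isLt
    by_cases h : i.val = j.val
    · have h1 : r - (i.val + 1) + i.val + 1 = r := by omega
      rw [← h, if_pos h1, if_pos rfl, ← mul_pow]
      norm_num
    · have h1 : ¬ r - (i.val + 1) + j.val + 1 = r := by omega
      rw [if_neg h1, if_neg h, mul_zero]
  · intro k _ hk
    have h1 : ¬ k.val + i.val + 1 = r := by
      intro h
      apply hk
      ext
      rw [Fin.val_rev]
      omega
    simp [antidiag, h1]
  · simp

theorem fromBlocks_transpose_mul_self {n : Type*} [Fintype n] [DecidableEq n]
    (A : Matrix n n ℝ) (hA : Aᵀ * A = 1) :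
    (fromBlocks 0 A Aᵀ 0)ᵀ * fromBlocks 0 A Aᵀ 0 = 1 := by
  have hA' : A * Aᵀ = 1 := mul_eq_one_comm.mp hA
  rw [fromBlocks_transpose, fromBlocks_multiply]
  simp [hA, hA', fromBlocks_one]

theorem kronecker_transpose_mul_self {m n : Type*} [Fintype n] [DecidableEq n] [Fintype m]
    [DecidableEq m] (A : Matrix m m ℝ) (M : Matrix n n ℝ) (hA : Aᵀ * A = 1) (hM : Mᵀ * M = 1) :
    (kronecker A M)ᵀ * kronecker A M = 1 := by
  change (kroneckerMap (· * ·) A M)ᵀ * kroneckerMap (· * ·) A M = 1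
  rw [← kroneckerMap_transpose, ← mul_kronecker_mul, hA, hM, one_kronecker_one]

theorem coe_units_mul_self (ε : ℤˣ) : ((ε : ℤ) : ℝ) * ((ε : ℤ) : ℝ) = 1 := by
  rcases Int.units_eq_one_or ε with rfl | rfl <;> norm_num

/-- Every row and column has exactly one nonzero entry, a sign. Both the independence of a block
family and the nondegeneracy of its span rest on this identity. -/
theorem gramMatrix_transpose_mul_self (c : CanonicalBlock) :
    c.gramMatrixᵀ * c.gramMatrix = 1 := by
  cases c with
  | complex a b r =>
    refine fromBlocks_transpose_mul_self _
      (kronecker_transpose_mul_self _ _ (antidiag_transpose_mul_self r) ?_)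
    ext i j
    fin_cases i <;> fin_cases j <;> simp [Matrix.mul_apply]
  | imaginary lam r ε =>
    have h : ∀ M : Matrix (Fin 2) (Fin 2) ℝ, Mᵀ * M = 1 →
        ((-((ε : ℤ) : ℝ)) • kronecker (antidiag r) M)ᵀ *
          ((-((ε : ℤ) : ℝ)) • kronecker (antidiag r) M) = 1 := by
      intro M hM
      rw [transpose_smul, smul_mul_smul_comm,
        kronecker_transpose_mul_self _ _ (antidiag_transpose_mul_self r) hM, neg_mul_neg,
        coe_units_mul_self, one_smul]
    refine h _ ?_
    split_ifs <;> ext i j <;> fin_cases i <;> fin_cases j <;> simp [Matrix.mul_apply]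
  | real mu r => exact fromBlocks_transpose_mul_self _ (antidiag_transpose_mul_self r)
  | nilpotentPair r => exact fromBlocks_transpose_mul_self _ (antidiag_transpose_mul_self r)
  | nilpotentSingle r ε =>
    have h : (((ε : ℤ) : ℝ) • antidiag r)ᵀ * (((ε : ℤ) : ℝ) • antidiag r) = 1 := by
      rw [transpose_smul, smul_mul_smul_comm, antidiag_transpose_mul_self, coe_units_mul_self,
        one_smul]
    exact h

theorem det_gramMatrix_ne_zero (c : CanonicalBlock) : c.gramMatrix.det ≠ 0 := by
  intro h
  have := congrArg det c.gramMatrix_transpose_mul_self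
  rw [det_mul, h, mul_zero, det_one] at this
  exact zero_ne_one this

theorem Valid.nonempty_idx {c : CanonicalBlock} (hc : c.Valid) : Nonempty c.Idx := by
  cases c with
  | complex a b r => exact ⟨Sum.inl (⟨0, hc.2.2⟩, 0)⟩
  | imaginary lam r ε => exact ⟨(⟨0, hc.2⟩, (0 : Fin 2))⟩
  | real mu r => exact ⟨Sum.inl ⟨0, hc.2⟩⟩
  | nilpotentPair r => exact ⟨Sum.inl ⟨0, hc.2⟩⟩
  | nilpotentSingle r ε => exact ⟨(⟨0, Odd.pos hc⟩ : Fin r)⟩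

variable {V : Type*} [AddCommGroup V] [Module ℝ V]

/-- The family `f` has the inner products of the canonical block `c`, and `J` acts on it through
the operator matrix of `c`. -/
structure IsBlockFamily (c : CanonicalBlock) (B : LinearMap.BilinForm ℝ V) (J : V →ₗ[ℝ] V)
    (f : c.Idx → V) : Prop where
  gram : ∀ i j, B (f i) (f j) = c.gramMatrix i j
  op : ∀ j, J (f j) = ∑ i, c.operatorMatrix i j • f i

namespace IsBlockFamily

variable {c : CanonicalBlock} {B : LinearMap.BilinForm ℝ V} {J : V →ₗ[ℝ] V} {f : c.Idx → V}

/-- Pairing a linear relation with each member shows that the invertible Gram matrix kills its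
coefficients, so independence never has to be checked on concrete chains. -/
theorem linearIndependent (hf : IsBlockFamily c B J f) : LinearIndependent ℝ f := by
  rw [Fintype.linearIndependent_iff]
  intro g hg
  have h : c.gramMatrix *ᵥ g = 0 := by
    ext j
    have := congrArg (B (f j)) hg
    simpa [Matrix.mulVec, dotProduct, hf.gram, mul_comm] using this
  have h2 : (c.gramMatrixᵀ * c.gramMatrix) *ᵥ g = 0 := by
    rw [← Matrix.mulVec_mulVec, h, Matrix.mulVec_zero]
  rw [gramMatrix_transpose_mul_self, Matrix.one_mulVec] at h2
  exact congrFun h2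

theorem map_mem_span (hf : IsBlockFamily c B J f) :
    ∀ x ∈ Submodule.span ℝ (Set.range f), J x ∈ Submodule.span ℝ (Set.range f) := by
  intro x hx
  induction hx using Submodule.span_induction with
  | mem x h =>
    obtain ⟨j, rfl⟩ := h
    rw [hf.op]
    exact Submodule.sum_mem _ fun i _ =>
      Submodule.smul_mem _ _ (Submodule.subset_span ⟨i, rfl⟩)
  | zero => simp
  | add x y _ _ hx hy => rw [map_add]; exact Submodule.add_mem _ hx hy
  | smul a x _ hx => rw [map_smul]; exact Submodule.smul_mem _ _ hx

theorem toMatrix_restrict_span (hf : IsBlockFamily c B J f) :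
    LinearMap.BilinForm.toMatrix (Module.Basis.span hf.linearIndependent)
      (B.restrict (Submodule.span ℝ (Set.range f))) = c.gramMatrix := by
  ext i j
  simp [LinearMap.BilinForm.toMatrix_apply, Module.Basis.span_apply, hf.gram,
    LinearMap.BilinForm.restrict_apply]

theorem isCarriedBy_span (hf : IsBlockFamily c B J f) :
    c.IsCarriedBy B J (Submodule.span ℝ (Set.range f)) := by
  refine ⟨hf.map_mem_span, Module.Basis.span hf.linearIndependent, ?_, hf.toMatrix_restrict_span⟩
  ext i j
  have h : J.restrict hf.map_mem_span (Module.Basis.span hf.linearIndependent j) =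
      ∑ i, c.operatorMatrix i j • Module.Basis.span hf.linearIndependent i := by
    apply Subtype.ext
    simp [LinearMap.restrict_apply, Module.Basis.span_apply, hf.op]
  rw [LinearMap.toMatrix_apply, h, Module.Basis.repr_sum_self]

theorem restrict_span_nondegenerate (hf : IsBlockFamily c B J f) :
    (B.restrict (Submodule.span ℝ (Set.range f))).Nondegenerate := by
  rw [LinearMap.BilinForm.nondegenerate_iff_det_ne_zero
    (Module.Basis.span hf.linearIndependent), hf.toMatrix_restrict_span]
  exact c.det_gramMatrix_ne_zero

end IsBlockFamily

end CanonicalBlock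

/-! ### Orthogonal sums and restrictions -/

namespace LinearMap.BilinForm

variable {V : Type*} [AddCommGroup V] [Module ℝ V] {B : LinearMap.BilinForm ℝ V}

theorem nondegenerate_of_forall (hB : ∀ x y, B x y = B y x) (h : ∀ x, (∀ y, B x y = 0) → x = 0) :
    B.Nondegenerate :=
  ⟨h, fun y hy => h y fun x => by rw [hB, hy]⟩

/-- A vector of `W i` lying in the sum of the other subspaces is orthogonal to `W i`, hence zero. -/
theorem isInternal_of_orthogonal_nondegenerate {ι : Type*} [DecidableEq ι]
    {W : ι → Submodule ℝ V}
    (horth : ∀ i j, i ≠ j → ∀ x ∈ W i, ∀ y ∈ W j, B x y = 0)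
    (hnd : ∀ i, (B.restrict (W i)).Nondegenerate) (htop : ⨆ i, W i = ⊤) :
    DirectSum.IsInternal W := by
  refine DirectSum.isInternal_submodule_of_iSupIndep_of_iSup_eq_top (fun i => ?_) htop
  rw [Submodule.disjoint_def]
  intro x hx hx'
  have key : ∀ y ∈ ⨆ j, ⨆ (_ : j ≠ i), W j, ∀ z ∈ W i, B y z = 0 := by
    intro y hy z hz
    have hle : ⨆ j, ⨆ (_ : j ≠ i), W j ≤ LinearMap.ker (B.flip z) :=
      iSup₂_le fun j hj y hy => horth j i hj y hy z hz
    exact hle hy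
  have h0 : (⟨x, hx⟩ : W i) = 0 := (hnd i).1 _ fun z => key x hx' z z.2
  exact congrArg Subtype.val h0

end LinearMap.BilinForm

namespace LinearMap

theorem minpoly_restrict_dvd {V : Type*} [AddCommGroup V] [Module ℝ V] (J : V →ₗ[ℝ] V)
    {U : Submodule ℝ V} (hU : ∀ x ∈ U, J x ∈ U) : minpoly ℝ (J.restrict hU) ∣ minpoly ℝ J := by
  have key : ∀ (p : Polynomial ℝ) (x : U),
      ((Polynomial.aeval (J.restrict hU) p x : U) : V) = Polynomial.aeval J p (x : V) := by
    intro p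
    induction p using Polynomial.induction_on' with
    | add p q hp hq => intro x; simp [hp, hq]
    | monomial n a =>
      intro x
      have h : ∀ (n : ℕ) (x : U), (((J.restrict hU) ^ n) x : V) = (J ^ n) (x : V) := by
        intro n
        induction n with
        | zero => simp
        | succ n ih => intro x; rw [pow_succ, pow_succ]; simp [ih]
      simp [Polynomial.aeval_monomial, h]
  refine minpoly.dvd _ _ (LinearMap.ext fun x => Subtype.ext ?_)
  rw [key, minpoly.aeval]
  rfl

end LinearMap

/-! ### Splitting off blocks by induction on the dimension -/

namespace CanonicalBlock

open LinearMap (BilinForm)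

/-- `W` is spanned by a family of the type of the valid block `c`, and the polynomial of `c`
divides the minimal polynomial of `J`. -/
def IsBlockSpan {V : Type*} [AddCommGroup V] [Module ℝ V] (B : BilinForm ℝ V) (J : V →ₗ[ℝ] V)
    (c : CanonicalBlock) (W : Submodule ℝ V) : Prop :=
  c.Valid ∧ c.poly ∣ minpoly ℝ J ∧
    ∃ f : c.Idx → V, c.IsBlockFamily B J f ∧ W = Submodule.span ℝ (Set.range f)

theorem exists_orthogonal_decomposition_of_exists_block
    {V : Type*} [AddCommGroup V] [Module ℝ V] [FiniteDimensional ℝ V]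
    (B : BilinForm ℝ V) (hB : ∀ x y, B x y = B y x)
    (J : V →ₗ[ℝ] V)
    (hex : ∀ (U : Submodule ℝ V) (hU : ∀ x ∈ U, J x ∈ U), U ≠ ⊥ →
      (B.restrict U).Nondegenerate → ∃ (c : CanonicalBlock) (f : c.Idx → U),
        c.Valid ∧ c.IsBlockFamily (B.restrict U) (J.restrict hU) f ∧
          c.poly ∣ minpoly ℝ (J.restrict hU))
    (hJ : ∀ x y, B (J x) y = -B x (J y)) (d : ℕ) :
    ∀ U : Submodule ℝ V, Module.finrank ℝ U = d → (∀ x ∈ U, J x ∈ U) →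
      (B.restrict U).Nondegenerate →
      ∃ (n : ℕ) (W : Fin n → Submodule ℝ V) (c : Fin n → CanonicalBlock),
        (⨆ i, W i = U) ∧ (∀ i j, i ≠ j → ∀ x ∈ W i, ∀ y ∈ W j, B x y = 0) ∧
          ∀ i, IsBlockSpan B J (c i) (W i) := by
  induction d using Nat.strong_induction_on with
  | _ d ih =>
  intro U hd hU hnd
  by_cases hbot : U = ⊥
  · refine ⟨0, Fin.elim0, Fin.elim0, ?_, fun i => i.elim0, fun i => i.elim0⟩
    rw [hbot]
    simp
  obtain ⟨c, f, hc, hf, hdvd⟩ := hex U hU hbot hnd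
  set g : c.Idx → V := fun i => (f i : V) with hg
  have hgf : c.IsBlockFamily B J g :=
    ⟨fun i j => hf.gram i j, fun j => by simpa using congrArg Subtype.val (hf.op j)⟩
  set W₀ := Submodule.span ℝ (Set.range g) with hW₀
  have hW₀U : W₀ ≤ U := Submodule.span_le.2 (by rintro _ ⟨i, rfl⟩; exact (f i).2)
  have hrefl : B.IsRefl := fun x y h => by rw [hB, h]
  have hcompl : IsCompl W₀ (B.orthogonal W₀) :=
    BilinForm.isCompl_orthogonal_of_restrict_nondegenerate hrefl hgf.restrict_span_nondegenerate
  have hUeq : W₀ ⊔ (U ⊓ B.orthogonal W₀) = U := by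
    rw [inf_comm, ← sup_inf_assoc_of_le _ hW₀U, hcompl.sup_eq_top, top_inf_eq]
  have hW₀ne : W₀ ≠ ⊥ := by
    obtain ⟨i⟩ := hc.nonempty_idx
    intro h
    exact hgf.linearIndependent.ne_zero i
      ((Submodule.mem_bot ℝ).1 (h ▸ Submodule.subset_span ⟨i, rfl⟩))
  have hlt : U ⊓ B.orthogonal W₀ < U := by
    refine lt_of_le_of_ne inf_le_left fun h => hW₀ne ?_
    have hle : W₀ ≤ B.orthogonal W₀ := hW₀U.trans (inf_eq_left.1 h)
    exact disjoint_self.1 (hcompl.disjoint.mono_right hle)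
  have hinv : ∀ x ∈ U ⊓ B.orthogonal W₀, J x ∈ U ⊓ B.orthogonal W₀ := by
    intro x hx
    refine ⟨hU x hx.1, fun w hw => ?_⟩
    have h := hx.2 (J w) (hgf.map_mem_span w hw)
    change B (J w) x = 0 at h
    change B w (J x) = 0
    rw [hJ] at h
    linarith
  -- A vector of the complement that is orthogonal to the complement is orthogonal to `W₀` too,
  -- hence to all of `U`.
  have hnd' : (B.restrict (U ⊓ B.orthogonal W₀)).Nondegenerate := by
    refine BilinForm.nondegenerate_of_forall (fun x y => hB x y) fun x hx => ?_
    have h0 : (⟨x, x.2.1⟩ : U) = 0 := by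
      refine hnd.1 _ fun y => ?_
      obtain ⟨w, hw, z, hz, hwz⟩ := Submodule.mem_sup.1 (hUeq.symm.le y.2)
      change B x y = 0
      have hxz : B x z = 0 := hx ⟨z, hz⟩
      have hwx : B w x = 0 := x.2.2 w hw
      rw [← hwz, map_add, hB x w, hwx, hxz, add_zero]
    exact Subtype.ext (show (x : V) = 0 from congrArg Subtype.val h0)
  obtain ⟨n, W, c', hsup, horth, hW⟩ :=
    ih _ (hd ▸ Submodule.finrank_lt_finrank_of_lt hlt) _ rfl hinv hnd'
  have hWle : ∀ i, W i ≤ B.orthogonal W₀ := fun i =>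
    (le_iSup W i).trans (hsup.le.trans inf_le_right)
  refine ⟨n + 1, Fin.cons W₀ W, Fin.cons c c', ?_, ?_, ?_⟩
  · rw [← hUeq, ← hsup]
    refine le_antisymm (iSup_le fun i => ?_) (sup_le (le_iSup_of_le 0 le_rfl)
      (iSup_le fun i => le_iSup_of_le i.succ le_rfl))
    refine Fin.cases ?_ (fun i => ?_) i
    · exact le_sup_left
    · exact le_sup_of_le_right (le_iSup W i)
  · intro i j
    refine Fin.cases ?_ (fun i => ?_) i <;> refine Fin.cases ?_ (fun j => ?_) j
    · exact fun h => absurd rfl h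
    · intro _ x hx y hy
      exact hWle j hy x hx
    · intro _ x hx y hy
      rw [hB]
      exact hWle i hx y hy
    · intro h x hx y hy
      exact horth i j (fun h' => h (congrArg Fin.succ h')) x hx y hy
  · refine Fin.cases ?_ hW
    exact ⟨hc, hdvd.trans (LinearMap.minpoly_restrict_dvd J hU), g, hgf, rfl⟩

end CanonicalBlock

open Polynomial

/-! ### Irreducible powers dividing the minimal polynomial -/

section Irreducible

variable {K V : Type*} [Field K] [AddCommGroup V] [Module K V]

/-- The gcd of q^(m+1) and the minimal polynomial kills `x` and is, up to a unit, a power of `q`; an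
exponent at most m is excluded because q^m does not kill `x`. -/
theorem pow_dvd_minpoly_of_irreducible [FiniteDimensional K V] {J : Module.End K V} {q : K[X]}
    (hq : Irreducible q) {m : ℕ} {x : V} (hx : aeval J (q ^ m) x ≠ 0)
    (hx' : aeval J (q ^ (m + 1)) x = 0) : q ^ (m + 1) ∣ minpoly K J := by
  classical
  set g := gcd (q ^ (m + 1)) (minpoly K J) with hg
  have hgx : aeval J g x = 0 := by
    obtain ⟨u, v, huv⟩ := exists_gcd_eq_mul_add_mul (q ^ (m + 1)) (minpoly K J)
    rw [hg, huv, mul_comm (q ^ (m + 1))]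
    simp [hx', -map_pow]
  obtain ⟨i, hi, hgi⟩ := (dvd_prime_pow hq.prime _).1 (gcd_dvd_left (q ^ (m + 1)) (minpoly K J))
  rcases Nat.lt_or_ge m i with h | h
  · obtain rfl : i = m + 1 := le_antisymm hi h
    exact hgi.symm.dvd.trans (gcd_dvd_right _ _)
  · obtain ⟨s, hs⟩ : g ∣ q ^ m := hgi.dvd.trans (pow_dvd_pow q h)
    refine absurd ?_ hx
    rw [hs, mul_comm, map_mul, Module.End.mul_apply, hgx, map_zero]

end Irreducible

/-! ### Adjoints and the skewadjoint Jordan decomposition -/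

namespace Module.End

variable {V : Type*} [AddCommGroup V] [Module ℝ V]

/-- On an invariant complement of the kernel, `T` is injective, hence surjective. This is the form
in which the semisimplicity of `S` is used later. -/
theorem IsSemisimple.exists_add_mem_ker [FiniteDimensional ℝ V] {T : Module.End ℝ V}
    (hT : T.IsSemisimple) (y : V) : ∃ y₁ y₂, T y₁ = 0 ∧ y = y₁ + T y₂ := by
  obtain ⟨C, hC, hcompl⟩ := (isSemisimple_iff.1 hT) (LinearMap.ker T) (fun x hx => by
    rw [LinearMap.mem_ker] at hx
    simp [hx])
  obtain ⟨y₁, hy₁, z, hz, rfl⟩ := Submodule.mem_sup.1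
    (hcompl.sup_eq_top.symm ▸ Submodule.mem_top (x := y))
  have hinj : Function.Injective (T.restrict hC) := by
    rw [← LinearMap.ker_eq_bot, LinearMap.ker_eq_bot']
    intro w hw
    have h1 : T w = 0 := congrArg Subtype.val hw
    exact Subtype.ext (Submodule.disjoint_def.1 hcompl.disjoint _ h1 w.2)
  obtain ⟨w, hw⟩ := LinearMap.surjective_of_injective hinj ⟨z, hz⟩
  exact ⟨y₁, w, hy₁, by rw [← show T w = z from congrArg Subtype.val hw]⟩

variable {B : LinearMap.BilinForm ℝ V} {J : Module.End ℝ V}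

theorem skew_aeval (hJ : ∀ x y, B (J x) y = -B x (J y)) (p : ℝ[X]) (x y : V) :
    B (aeval J p x) y = B x (aeval J (p.comp (-X)) y) := by
  induction p using Polynomial.induction_on' with
  | add p q hp hq => simp [hp, hq]
  | monomial n a =>
    have h : ∀ (n : ℕ) (x y : V), B ((J ^ n) x) y = B x (((-J) ^ n) y) := by
      intro n
      induction n with
      | zero => simp
      | succ n ih =>
        intro x y
        rw [pow_succ, pow_succ', Module.End.mul_apply, Module.End.mul_apply, ih, hJ]
        simp
    rw [← C_mul_X_pow_eq_monomial]
    simp [h]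

theorem aeval_comp_neg_eq_zero (hB : B.Nondegenerate) (hJ : ∀ x y, B (J x) y = -B x (J y))
    {p : ℝ[X]} (hp : aeval J p = 0) : aeval J (p.comp (-X)) = 0 := by
  ext y
  exact hB.2 _ fun x => by rw [← skew_aeval hJ, hp]; simp

/-- A skewadjoint operator is the sum of commuting skewadjoint operators, the one semisimple and
the other nilpotent. -/
theorem exists_skew_isSemisimple_isNilpotent [FiniteDimensional ℝ V] (hB : B.Nondegenerate)
    (hJ : ∀ x y, B (J x) y = -B x (J y)) :
    ∃ S N : Module.End ℝ V, J = S + N ∧ (∀ x, S (N x) = N (S x)) ∧ S.IsSemisimple ∧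
      IsNilpotent N ∧ (∀ x y, B (S x) y = -B x (S y)) ∧ (∀ x y, B (N x) y = -B x (N y)) := by
  obtain ⟨n, hn, s, hs, hnil, hss, hJns⟩ := J.exists_isNilpotent_isSemisimple
  rw [Algebra.adjoin_singleton_eq_range_aeval] at hn hs
  obtain ⟨f, rfl⟩ := hs
  obtain ⟨g, rfl⟩ := hn
  change (aeval J f).IsSemisimple at hss
  change IsNilpotent (aeval J g) at hnil
  change J = aeval J g + aeval J f at hJns
  have hcomm : ∀ p q : ℝ[X], Commute (aeval J p) (aeval J q) := fun p q => by
    rw [Commute, SemiconjBy, ← map_mul, mul_comm, map_mul]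
  -- If μ is the squarefree minimal polynomial of f(J), then μ ∘ f kills `J`; taking adjoints, μ
  -- kills f(-J).
  have hss' : (aeval J (f.comp (-X))).IsSemisimple := by
    refine isSemisimple_of_squarefree_aeval_eq_zero hss.minpoly_squarefree ?_
    have h := aeval_comp_neg_eq_zero hB hJ (p := (minpoly ℝ (aeval J f)).comp f)
      (by rw [aeval_comp, minpoly.aeval])
    rwa [comp_assoc, aeval_comp] at h
  have hnil' : IsNilpotent (aeval J (g.comp (-X))) := by
    obtain ⟨k, hk⟩ := hnil
    refine ⟨k, ?_⟩
    have h := aeval_comp_neg_eq_zero hB hJ (p := g ^ k) (by rw [map_pow, hk])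
    rwa [pow_comp, map_pow] at h
  have hneg : aeval J (g.comp (-X)) + aeval J (f.comp (-X)) = -J := by
    have : ∀ x y, B x ((aeval J (g.comp (-X)) + aeval J (f.comp (-X))) y) = B x ((-J) y) := by
      intro x y
      rw [LinearMap.add_apply, map_add, ← skew_aeval hJ, ← skew_aeval hJ, ← LinearMap.add_apply,
        ← map_add, ← LinearMap.add_apply, ← hJns, hJ]
      simp
    ext y
    refine sub_eq_zero.1 (hB.2 _ fun x => ?_)
    rw [map_sub, this, sub_self]
  have hskew : ∀ p : ℝ[X], ∀ x y, B (((1 / 2 : ℝ) • (aeval J p - aeval J (p.comp (-X)))) x) y =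
      -B x (((1 / 2 : ℝ) • (aeval J p - aeval J (p.comp (-X)))) y) := by
    intro p x y
    have h : (p.comp (-X)).comp (-X) = p := by simp [comp_assoc]
    simp only [LinearMap.smul_apply, LinearMap.sub_apply, map_smul, map_sub, smul_eq_mul,
      skew_aeval hJ, h]
    ring
  -- Both summands are replaced by their skew parts, half the difference with the adjoint. These add
  -- up to `J` since the adjoints add up to `-J`, and as all operators are polynomials in `J`, hence
  -- commute, semisimplicity and nilpotency survive.
  refine ⟨(1 / 2 : ℝ) • (aeval J f - aeval J (f.comp (-X))),
    (1 / 2 : ℝ) • (aeval J g - aeval J (g.comp (-X))), ?_, ?_, ?_, ?_, hskew f, hskew g⟩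
  · have h : aeval J f = J - aeval J g := by rw [eq_sub_iff_add_eq, add_comm]; exact hJns.symm
    have h' : aeval J (f.comp (-X)) = -J - aeval J (g.comp (-X)) := by
      rw [eq_sub_iff_add_eq, add_comm]; exact hneg
    rw [h, h']
    module
  · intro x
    have h : Commute ((1 / 2 : ℝ) • (aeval J f - aeval J (f.comp (-X))))
        ((1 / 2 : ℝ) • (aeval J g - aeval J (g.comp (-X)))) := by
      rw [← map_sub, ← map_sub, ← map_smul, ← map_smul]
      exact hcomm _ _
    exact LinearMap.congr_fun h.eq x
  · exact IsSemisimple_smul _ (hss.sub_of_commute (hcomm _ _) hss')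
  · exact ((hcomm _ _).isNilpotent_sub hnil hnil').smul _

end Module.End

/-! ### Powers of skew operators and functionals on chains -/

namespace LinearMap.BilinForm

variable {V : Type*} [AddCommGroup V] [Module ℝ V] {B : LinearMap.BilinForm ℝ V}

theorem skew_pow {N : Module.End ℝ V} (hN : ∀ x y, B (N x) y = -B x (N y)) (k : ℕ) (x y : V) :
    B ((N ^ k) x) y = (-1) ^ k * B x ((N ^ k) y) := by
  induction k generalizing x y with
  | zero => simp
  | succ k ih =>
    rw [pow_succ, Module.End.mul_apply, ih, hN, ← Module.End.mul_apply, ← pow_succ', pow_succ,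
      pow_succ]
    ring

theorem skew_pow_apply_pow {N : Module.End ℝ V} (hN : ∀ x y, B (N x) y = -B x (N y)) (i j : ℕ)
    (x y : V) : B ((N ^ i) x) ((N ^ j) y) = (-1) ^ j * B ((N ^ (i + j)) x) y := by
  rw [add_comm, pow_add, Module.End.mul_apply, skew_pow hN j, ← mul_assoc, ← mul_pow]
  norm_num

theorem exists_apply_eq [FiniteDimensional ℝ V] (hB : ∀ x y, B x y = B y x) (hnd : B.Nondegenerate)
    (φ : V →ₗ[ℝ] ℝ) : ∃ y, ∀ v, B v y = φ v := by
  refine ⟨(B.toDual hnd).symm φ, fun v => ?_⟩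
  rw [hB, apply_toDual_symm_apply]

end LinearMap.BilinForm

/-- The map (f₀, …, f_m) ↦ ∑ N^k α(f_k) is injective: in a relation with first nonzero coefficient
f_k, applying N^(m-k) isolates N^m α(f_k). The functional is `ψ` of the last coordinate of a left
inverse. `F` will be ℝ for one chain and ℝ² for a chain with its companion. -/
theorem exists_functional_on_chains {F V : Type*} [AddCommGroup F] [Module ℝ F] [AddCommGroup V]
    [Module ℝ V] {N : Module.End ℝ V} {α : F →ₗ[ℝ] V} {m : ℕ}
    (hα : ∀ f, (N ^ m) (α f) = 0 → f = 0) (hα' : ∀ f, (N ^ (m + 1)) (α f) = 0) (ψ : F →ₗ[ℝ] ℝ) :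
    ∃ φ : V →ₗ[ℝ] ℝ, ∀ k f, φ ((N ^ k) (α f)) = if k = m then ψ f else 0 := by
  classical
  have hzero : ∀ k f, m < k → (N ^ k) (α f) = 0 := by
    intro k f hk
    obtain ⟨l, rfl⟩ := Nat.exists_eq_add_of_lt hk
    rw [show m + l + 1 = l + (m + 1) by ring, pow_add, Module.End.mul_apply, hα', map_zero]
  let L : (Fin (m + 1) → F) →ₗ[ℝ] V :=
    ∑ k : Fin (m + 1), (N ^ k.val) ∘ₗ α ∘ₗ LinearMap.proj k
  have hL : ∀ c, L c = ∑ k : Fin (m + 1), (N ^ k.val) (α (c k)) := by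
    intro c
    simp [L, LinearMap.sum_apply]
  have hker : LinearMap.ker L = ⊥ := by
    rw [LinearMap.ker_eq_bot']
    intro c hc
    rw [hL] at hc
    have key : ∀ k (hk : k < m + 1), c ⟨k, hk⟩ = 0 := by
      intro k
      induction k using Nat.strong_induction_on with
      | _ k ih =>
        intro hk
        have h := congrArg (N ^ (m - k)) hc
        rw [map_sum, map_zero, Finset.sum_eq_single ⟨k, hk⟩] at h
        · refine hα _ ?_
          rwa [← Module.End.mul_apply, ← pow_add, Nat.sub_add_cancel (Nat.le_of_lt_succ hk)] at h
        · intro j _ hj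
          rcases lt_trichotomy j.val k with h1 | h1 | h1
          · rw [show c j = 0 from ih j.val h1 j.isLt]
            simp
          · exact absurd (Fin.ext h1) hj
          · rw [← Module.End.mul_apply, ← pow_add]
            exact hzero _ _ (by omega)
        · simp
    exact funext fun k => key k.val k.isLt
  obtain ⟨g, hg⟩ := LinearMap.exists_leftInverse_of_injective L hker
  refine ⟨ψ ∘ₗ LinearMap.proj (Fin.last m) ∘ₗ g, fun k f => ?_⟩
  rcases Nat.lt_or_ge m k with h | h
  · rw [hzero k f h, map_zero, if_neg h.ne']
  · have h1 : (N ^ k) (α f) = L (Pi.single ⟨k, Nat.lt_succ_of_le h⟩ f) := by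
      rw [hL, Finset.sum_eq_single ⟨k, Nat.lt_succ_of_le h⟩]
      · simp
      · intro j _ hj
        simp [Pi.single_eq_of_ne hj]
      · simp
    have h2 : g ((N ^ k) (α f)) = Pi.single ⟨k, Nat.lt_succ_of_le h⟩ f := by
      rw [h1, ← LinearMap.comp_apply, hg, LinearMap.id_apply]
    simp only [LinearMap.comp_apply, h2, LinearMap.proj_apply]
    split_ifs with hk
    · subst hk
      rw [show (⟨k, Nat.lt_succ_of_le h⟩ : Fin (k + 1)) = Fin.last k from rfl, Pi.single_eq_same]
    · rw [Pi.single_eq_of_ne, map_zero]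
      intro h3
      exact hk (congrArg Fin.val h3).symm

/-- The operator `J` is the sum of commuting operators `S`, semisimple, and `N`, nilpotent, all
skewadjoint for the nondegenerate symmetric form `B`. -/
structure SkewJordanDecomposition {V : Type*} [AddCommGroup V] [Module ℝ V]
    (B : LinearMap.BilinForm ℝ V) (J S N : Module.End ℝ V) : Prop where
  symm : ∀ x y, B x y = B y x
  nondegenerate : B.Nondegenerate
  eq_add : J = S + N
  comm : ∀ x, S (N x) = N (S x)
  isSemisimple : S.IsSemisimple
  isNilpotent : IsNilpotent N
  skew_left : ∀ x y, B (S x) y = -B x (S y)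
  skew_right : ∀ x y, B (N x) y = -B x (N y)

/-! ### Maximal chains and dual vectors -/

namespace SkewJordanDecomposition

variable {V : Type*} [AddCommGroup V] [Module ℝ V] {B : LinearMap.BilinForm ℝ V}
  {J S N : Module.End ℝ V}

theorem comm_pow (h : SkewJordanDecomposition B J S N) (k : ℕ) (x : V) :
    S ((N ^ k) x) = (N ^ k) (S x) := by
  have h1 : Commute S N := LinearMap.ext h.comm
  exact LinearMap.congr_fun (h1.pow_right k).eq x

theorem comm_aeval_pow (h : SkewJordanDecomposition B J S N) (p : ℝ[X]) (k : ℕ) (x : V) :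
    aeval S p ((N ^ k) x) = (N ^ k) (aeval S p x) := by
  have h1 : Commute S N := LinearMap.ext h.comm
  have h2 : Commute N (aeval S p) := Algebra.commute_of_mem_adjoin_singleton_of_commute
    (aeval_mem_adjoin_singleton ℝ S) h1.symm
  exact LinearMap.congr_fun (h2.symm.pow_right k).eq x

/-- The exponent is maximal for the whole kernel and not only for `x`, so `x` may later be changed
inside the kernel without losing N^(m+1) x = 0. -/
theorem exists_max_chain (h : SkewJordanDecomposition B J S N) (p : ℝ[X]) {x₀ : V}
    (hx₀ : x₀ ≠ 0) (hpx₀ : aeval S p x₀ = 0) :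
    ∃ m x, aeval S p x = 0 ∧ (N ^ m) x ≠ 0 ∧ ∀ v, aeval S p v = 0 → (N ^ (m + 1)) v = 0 := by
  classical
  have hex : ∃ k, ∀ v, aeval S p v = 0 → (N ^ k) v = 0 := by
    obtain ⟨k, hk⟩ := h.isNilpotent
    exact ⟨k, fun v _ => by rw [hk]; rfl⟩
  have hspec := Nat.find_spec hex
  have hmin := fun m (hm : m < Nat.find hex) => Nat.find_min hex hm
  generalize Nat.find hex = k at hspec hmin
  cases k with
  | zero => exact absurd (hspec x₀ hpx₀) (by simpa using hx₀)
  | succ m =>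
    obtain ⟨x, hx⟩ := not_forall.1 (hmin m (Nat.lt_succ_self m))
    obtain ⟨h1, h2⟩ := Classical.not_imp.1 hx
    exact ⟨m, x, h1, h2, hspec⟩

variable [FiniteDimensional ℝ V]

/-- Represent `φ` by a vector and drop its component in the image of p(-S), which is orthogonal to
ker p(S). -/
theorem exists_mem_ker_pairing (h : SkewJordanDecomposition B J S N) (p : ℝ[X])
    (φ : V →ₗ[ℝ] ℝ) :
    ∃ y, aeval S (p.comp (-X)) y = 0 ∧ ∀ v, aeval S p v = 0 → B v y = φ v := by
  obtain ⟨y, hy⟩ := LinearMap.BilinForm.exists_apply_eq h.symm h.nondegenerate φ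
  obtain ⟨y₁, y₂, hy₁, rfl⟩ := (h.isSemisimple.aeval (p.comp (-X))).exists_add_mem_ker y
  refine ⟨y₁, hy₁, fun v hv => ?_⟩
  rw [← hy, map_add, ← Module.End.skew_aeval h.skew_left, hv]
  simp

theorem exists_mem_ker_comp_neg_ne_zero (h : SkewJordanDecomposition B J S N) (p : ℝ[X]) {x : V}
    (hx : x ≠ 0) (hpx : aeval S p x = 0) : ∃ y, y ≠ 0 ∧ aeval S (p.comp (-X)) y = 0 := by
  obtain ⟨φ, hφ⟩ := not_forall.1 (mt (Module.forall_dual_apply_eq_zero_iff ℝ x).1 hx)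
  obtain ⟨y, hy, hyv⟩ := h.exists_mem_ker_pairing p φ
  refine ⟨y, ?_, hy⟩
  rintro rfl
  exact hφ (by rw [← hyv x hpx, map_zero])

/-- Test N^k y against ker p(S) + im p(S): up to sign N^k moves over to the first summand and kills
it, and the second is orthogonal to ker p(-S). -/
theorem pow_eq_zero_on_ker_comp_neg (h : SkewJordanDecomposition B J S N) {p : ℝ[X]} {k : ℕ}
    (hk : ∀ v, aeval S p v = 0 → (N ^ k) v = 0) {y : V} (hy : aeval S (p.comp (-X)) y = 0) :
    (N ^ k) y = 0 := by
  refine h.nondegenerate.1 _ fun z => ?_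
  obtain ⟨z₁, z₂, hz₁, rfl⟩ := (h.isSemisimple.aeval p).exists_add_mem_ker z
  rw [map_add, LinearMap.BilinForm.skew_pow h.skew_right, hk _ hz₁, h.symm _ (aeval S p z₂),
    Module.End.skew_aeval h.skew_left, h.comm_aeval_pow, hy]
  simp

theorem exists_dual_vector (h : SkewJordanDecomposition B J S N) {F : Type*} [AddCommGroup F]
    [Module ℝ F] {p : ℝ[X]} {α : F →ₗ[ℝ] V} {m : ℕ} (hpα : ∀ f, aeval S p (α f) = 0)
    (hα : ∀ f, (N ^ m) (α f) = 0 → f = 0) (hα' : ∀ f, (N ^ (m + 1)) (α f) = 0)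
    (ψ : F →ₗ[ℝ] ℝ) :
    ∃ y, aeval S (p.comp (-X)) y = 0 ∧
      ∀ k f, B ((N ^ k) (α f)) y = if k = m then ψ f else 0 := by
  obtain ⟨φ, hφ⟩ := exists_functional_on_chains hα hα' ψ
  obtain ⟨y, hy, hyv⟩ := h.exists_mem_ker_pairing p φ
  refine ⟨y, hy, fun k f => ?_⟩
  rw [hyv _ (by rw [h.comm_aeval_pow, hpα, map_zero]), hφ]

theorem exists_dual_vector_single (h : SkewJordanDecomposition B J S N) {p : ℝ[X]} {m : ℕ} {x : V}
    (hpx : aeval S p x = 0) (hx : (N ^ m) x ≠ 0) (hx' : (N ^ (m + 1)) x = 0) :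
    ∃ y, aeval S (p.comp (-X)) y = 0 ∧ ∀ k, B ((N ^ k) x) y = if k = m then 1 else 0 := by
  obtain ⟨y, hy, hxy⟩ := h.exists_dual_vector (p := p) (α := LinearMap.toSpanSingleton ℝ V x)
    (m := m) (fun f => by simp [hpx]) (fun f hf => by simpa [hx] using hf)
    (fun f => by simp [hx']) LinearMap.id
  exact ⟨y, hy, fun k => by simpa using hxy k 1⟩

end SkewJordanDecomposition

/-! ### Chains as block families -/

namespace CanonicalBlock

open Matrix

variable {V : Type*} [AddCommGroup V] [Module ℝ V]

/-- Indexing the chain by ℕ lets `hg` encode the convention v_{r+1} = 0, so the last column has the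
same formula as the others. -/
theorem sum_jordan_smul {m : ℕ} (mu : ℝ) (g : ℕ → V) (hg : g (m + 1) = 0) (j : Fin (m + 1)) :
    ∑ i, jordan (m + 1) mu i j • g i.val = mu • g j.val + g (j.val + 1) := by
  have h : ∀ i : Fin (m + 1), jordan (m + 1) mu i j • g i.val =
      (if i = j then mu • g j.val else 0) + if i.val = j.val + 1 then g (j.val + 1) else 0 := by
    intro i
    simp only [jordan, of_apply]
    by_cases h1 : i = j
    · subst h1
      simp
    · by_cases h2 : i.val = j.val + 1
      · simp [h1, h2]
      · simp [h1, h2]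
  rw [Finset.sum_congr rfl fun i _ => h i, Finset.sum_add_distrib, Finset.sum_ite_eq' Finset.univ j,
    if_pos (Finset.mem_univ _)]
  congr 1
  by_cases hj : j.val + 1 < m + 1
  · rw [Finset.sum_eq_single ⟨j.val + 1, hj⟩]
    · simp
    · intro i _ hi
      rw [if_neg fun h' => hi (Fin.ext h')]
    · simp
  · have hj' : j.val + 1 = m + 1 := by omega
    rw [hj', hg]
    simp

theorem sum_realJordan_smul {m : ℕ} (M : Matrix (Fin 2) (Fin 2) ℝ) (g : ℕ → Fin 2 → V)
    (hg : ∀ s, g (m + 1) s = 0) (q : Fin (m + 1) × Fin 2) :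
    ∑ p, realJordan (m + 1) M p q • g p.1.val p.2 =
      ∑ s, M s q.2 • g q.1.val s + g (q.1.val + 1) q.2 := by
  rw [Fintype.sum_prod_type_right]
  obtain ⟨j, t⟩ := q
  have h : ∀ s, ∑ i, realJordan (m + 1) M (i, s) (j, t) • g i.val s =
      M s t • g j.val s + if s = t then g (j.val + 1) t else 0 := by
    intro s
    have h1 : ∀ i, realJordan (m + 1) M (i, s) (j, t) • g i.val s =
        jordan (m + 1) (M s t) i j • (if i = j ∨ s = t then g i.val s else 0) := by
      intro i
      simp only [realJordan, jordan, of_apply]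
      by_cases h1 : i = j
      · simp [h1]
      · by_cases h2 : s = t <;> simp [h1, h2]
    by_cases hst : s = t
    · subst hst
      simp only [h1, or_true, if_true]
      exact sum_jordan_smul (M s s) (fun k => g k s) (hg s) j
    · rw [if_neg hst, add_zero, Finset.sum_eq_single j]
      · simp [h1, jordan]
      · intro i _ hij
        simp [h1, hij, hst]
      · simp
  rw [Finset.sum_congr rfl fun s _ => h s, Finset.sum_add_distrib,
    Finset.sum_ite_eq' Finset.univ t, if_pos (Finset.mem_univ _)]

end CanonicalBlock

namespace SkewJordanDecomposition

open CanonicalBlock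

variable {V : Type*} [AddCommGroup V] [Module ℝ V] {B : LinearMap.BilinForm ℝ V}
  {J S N : Module.End ℝ V}

theorem apply_chain (h : SkewJordanDecomposition B J S N) {m : ℕ} {mu : ℝ} {x : V}
    (hx : S x = mu • x) (hNx : (N ^ (m + 1)) x = 0) (j : Fin (m + 1)) :
    J ((N ^ j.val) x) = ∑ i : Fin (m + 1), jordan (m + 1) mu i j • (N ^ i.val) x := by
  rw [sum_jordan_smul mu (fun k => (N ^ k) x) hNx, h.eq_add, LinearMap.add_apply, h.comm_pow, hx,
    map_smul, pow_succ', Module.End.mul_apply]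

theorem apply_real_chain (h : SkewJordanDecomposition B J S N) {m : ℕ}
    {M : Matrix (Fin 2) (Fin 2) ℝ} {x : Fin 2 → V} (hx : ∀ t, S (x t) = ∑ s, M s t • x s)
    (hNx : ∀ s, (N ^ (m + 1)) (x s) = 0) (q : Fin (m + 1) × Fin 2) :
    J ((N ^ q.1.val) (x q.2)) =
      ∑ p : Fin (m + 1) × Fin 2, realJordan (m + 1) M p q • (N ^ p.1.val) (x p.2) := by
  rw [sum_realJordan_smul M (fun k s => (N ^ k) (x s)) hNx, h.eq_add, LinearMap.add_apply,
    h.comm_pow, hx, map_sum, pow_succ', Module.End.mul_apply]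
  simp

/-- Moving N^j across the form costs (-1)^j and leaves only the exponent i + j. Hence the numbers
⟨N^k x, y⟩ determine a whole Gram block; counted from 0, i + j = m is the condition h + j = r + 1
with r = m + 1. -/
theorem gram_chain (h : SkewJordanDecomposition B J S N) {m : ℕ} {x y : V} {d : ℝ}
    (hxy : ∀ k, B ((N ^ k) x) y = if k = m then d else 0) (i j : Fin (m + 1)) :
    B ((N ^ i.val) x) ((N ^ j.val) y) = d * antidiag (m + 1) i j := by
  rw [LinearMap.BilinForm.skew_pow_apply_pow h.skew_right, hxy, antidiag, Matrix.of_apply]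
  have : i.val + j.val = m ↔ i.val + j.val + 1 = m + 1 := by omega
  simp only [this]
  split_ifs <;> ring

theorem isBlockFamily_pair (h : SkewJordanDecomposition B J S N) {m : ℕ} {mu : ℝ} {x y : V}
    (hSx : S x = mu • x) (hSy : S y = (-mu) • y) (hx : (N ^ (m + 1)) x = 0)
    (hy : (N ^ (m + 1)) y = 0) (hxy : ∀ k, B ((N ^ k) x) y = if k = m then 1 else 0)
    (hxx : ∀ k, B ((N ^ k) x) x = 0) (hyy : ∀ k, B ((N ^ k) y) y = 0) :
    (real mu (m + 1)).IsBlockFamily B J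
      (Sum.elim (fun i : Fin (m + 1) => (N ^ i.val) x) fun i : Fin (m + 1) => (N ^ i.val) y) := by
  constructor
  · have hxy' : ∀ i j : Fin (m + 1), B ((N ^ i.val) x) ((N ^ j.val) y) = antidiag (m + 1) i j :=
      fun i j => by rw [h.gram_chain hxy, one_mul]
    rintro (i | i) (j | j)
    · change B ((N ^ i.val) x) ((N ^ j.val) x) = 0
      rw [LinearMap.BilinForm.skew_pow_apply_pow h.skew_right, hxx, mul_zero]
    · exact hxy' i j
    · exact (h.symm _ _).trans (hxy' j i)
    · change B ((N ^ i.val) y) ((N ^ j.val) y) = 0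
      rw [LinearMap.BilinForm.skew_pow_apply_pow h.skew_right, hyy, mul_zero]
  · rintro (j | j)
    · refine (h.apply_chain hSx hx j).trans (Eq.symm ((Fintype.sum_sum_type _).trans ?_))
      simp [operatorMatrix]
    · refine (h.apply_chain hSy hy j).trans (Eq.symm ((Fintype.sum_sum_type _).trans ?_))
      simp [operatorMatrix]

theorem isBlockFamily_complex (h : SkewJordanDecomposition B J S N) {m : ℕ} {a b : ℝ}
    {x y : Fin 2 → V}
    (hSx : ∀ t, S (x t) = ∑ s, !![a, b; -b, a] s t • x s)
    (hSy : ∀ t, S (y t) = ∑ s, !![-a, -b; b, -a] s t • y s)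
    (hx : ∀ s, (N ^ (m + 1)) (x s) = 0) (hy : ∀ s, (N ^ (m + 1)) (y s) = 0)
    (hxy : ∀ k s t, B ((N ^ k) (x s)) (y t) = if k = m then !![1, 0; 0, -1] s t else 0)
    (hxx : ∀ k s t, B ((N ^ k) (x s)) (x t) = 0) (hyy : ∀ k s t, B ((N ^ k) (y s)) (y t) = 0) :
    (complex a b (m + 1)).IsBlockFamily B J
      (Sum.elim (fun p : Fin (m + 1) × Fin 2 => (N ^ p.1.val) (x p.2))
        fun p : Fin (m + 1) × Fin 2 => (N ^ p.1.val) (y p.2)) := by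
  constructor
  · have hxy' : ∀ p q : Fin (m + 1) × Fin 2, B ((N ^ p.1.val) (x p.2)) ((N ^ q.1.val) (y q.2)) =
        Matrix.kronecker (antidiag (m + 1)) !![1, 0; 0, -1] p q := fun p q => by
      rw [h.gram_chain (fun k => hxy k p.2 q.2), mul_comm]
      rfl
    rintro (i | i) (j | j)
    · change B ((N ^ i.1.val) (x i.2)) ((N ^ j.1.val) (x j.2)) = 0
      rw [LinearMap.BilinForm.skew_pow_apply_pow h.skew_right, hxx, mul_zero]
    · exact hxy' i j
    · exact (h.symm _ _).trans (hxy' j i)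
    · change B ((N ^ i.1.val) (y i.2)) ((N ^ j.1.val) (y j.2)) = 0
      rw [LinearMap.BilinForm.skew_pow_apply_pow h.skew_right, hyy, mul_zero]
  · rintro (j | j)
    · refine (h.apply_real_chain hSx hx j).trans (Eq.symm ((Fintype.sum_sum_type _).trans ?_))
      simp [operatorMatrix]
    · refine (h.apply_real_chain hSy hy j).trans (Eq.symm ((Fintype.sum_sum_type _).trans ?_))
      simp [operatorMatrix]

/-- On an eigenspace of `S` the operator J - mu acts as `N`. -/
theorem linear_pow_dvd_minpoly [FiniteDimensional ℝ V] (h : SkewJordanDecomposition B J S N)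
    {m : ℕ} {mu : ℝ} {x : V} (hSx : S x = mu • x) (hx : (N ^ m) x ≠ 0)
    (hx' : (N ^ (m + 1)) x = 0) : (X - C mu) ^ (m + 1) ∣ minpoly ℝ J := by
  have key : ∀ k, aeval J ((X - C mu) ^ k) x = (N ^ k) x := by
    intro k
    induction k with
    | zero => simp
    | succ k ih =>
      rw [pow_succ', map_mul, Module.End.mul_apply, ih, pow_succ', Module.End.mul_apply]
      simp [h.eq_add, h.comm_pow, hSx, Module.algebraMap_end_apply]
  exact pow_dvd_minpoly_of_irreducible (irreducible_X_sub_C mu) (by rwa [key]) (by rwa [key])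

end SkewJordanDecomposition

/-- The real polynomial with the roots `a ± ib`. -/
noncomputable def quadraticPoly (a b : ℝ) : ℝ[X] := X ^ 2 - C (2 * a) * X + C (a ^ 2 + b ^ 2)

/-! ### Real quadratic factors -/

theorem quadraticPoly_comp_neg (a b : ℝ) :
    (quadraticPoly a b).comp (-X) = quadraticPoly (-a) b := by
  simp [quadraticPoly]

theorem quadraticPoly_neg (a b : ℝ) :
    quadraticPoly (-a) b = X ^ 2 + C (2 * a) * X + C (a ^ 2 + b ^ 2) := by
  simp [quadraticPoly]

theorem natDegree_quadraticPoly (a b : ℝ) : (quadraticPoly a b).natDegree = 2 := by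
  unfold quadraticPoly
  compute_degree!

theorem quadraticPoly_ne_zero (a b : ℝ) : quadraticPoly a b ≠ 0 := by
  intro h
  have := natDegree_quadraticPoly a b
  rw [h, natDegree_zero] at this
  omega

theorem irreducible_quadraticPoly {a b : ℝ} (hb : b ≠ 0) : Irreducible (quadraticPoly a b) := by
  refine irreducible_of_degree_le_three_of_not_isRoot ?_ fun t ht => ?_
  · rw [natDegree_quadraticPoly]
    simp
  · have h : (t - a) ^ 2 + b ^ 2 = 0 := by
      simp only [quadraticPoly, IsRoot.def, eval_add, eval_sub, eval_pow, eval_mul, eval_C,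
        eval_X] at ht
      linarith
    have := sq_nonneg (t - a)
    have := pow_pos (abs_pos.2 hb) 2
    rw [sq_abs] at this
    linarith

theorem isCoprime_quadraticPoly_neg {a b : ℝ} (ha : a ≠ 0) :
    IsCoprime (quadraticPoly a b) (quadraticPoly (-a) b) := by
  have hc : a ^ 2 + b ^ 2 ≠ 0 := by positivity
  -- With p and p' the two quadratics, a² + b² = p - X(X - 2a) and X = (p' - p)/(4a); substituting
  -- gives the Bézout coefficients.
  refine ⟨C (1 / (a ^ 2 + b ^ 2)) * (1 + (X - C (2 * a)) * C (1 / (4 * a))),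
    -(C (1 / (a ^ 2 + b ^ 2)) * (X - C (2 * a)) * C (1 / (4 * a))), ?_⟩
  have h1 : C (1 / (a ^ 2 + b ^ 2)) * C (a ^ 2 + b ^ 2) = (1 : ℝ[X]) := by
    rw [← C_mul, one_div_mul_cancel hc, C_1]
  have h2 : C (1 / (4 * a)) * C (2 * a) * 2 = (1 : ℝ[X]) := by
    rw [← C_mul, show (2 : ℝ[X]) = C 2 from rfl, ← C_mul, ← C_1]
    congr 1
    field_simp
    norm_num
  rw [quadraticPoly_neg, quadraticPoly]
  linear_combination h1 - C (1 / (a ^ 2 + b ^ 2)) * X * (X - C (2 * a)) * h2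

theorem aeval_quadraticPoly {V : Type*} [AddCommGroup V] [Module ℝ V] (S : Module.End ℝ V)
    (a b : ℝ) (x : V) :
    aeval S (quadraticPoly a b) x = S (S x) - (2 * a) • S x + (a ^ 2 + b ^ 2) • x := by
  simp only [quadraticPoly, map_add, map_sub, map_mul, aeval_X, aeval_C,
    LinearMap.add_apply, LinearMap.sub_apply, Module.End.mul_apply, pow_two,
    Module.algebraMap_end_apply]
  module

/-- Some valid canonical block is spanned by a family in the space of `J`, and its polynomial
divides the minimal polynomial of `J`. -/
def HasBlockFamily {V : Type*} [AddCommGroup V] [Module ℝ V] (B : LinearMap.BilinForm ℝ V)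
    (J : V →ₗ[ℝ] V) : Prop :=
  ∃ (c : CanonicalBlock) (f : c.Idx → V),
    c.Valid ∧ c.IsBlockFamily B J f ∧ c.poly ∣ minpoly ℝ J

/-! ### Eigenvalues off the imaginary axis -/

namespace SkewJordanDecomposition

open CanonicalBlock

variable {V : Type*} [AddCommGroup V] [Module ℝ V] {B : LinearMap.BilinForm ℝ V}
  {J S N : Module.End ℝ V}

theorem apply_eq_zero_of_eigenvector (h : SkewJordanDecomposition B J S N) {mu : ℝ} (hmu : mu ≠ 0)
    {x y : V} (hx : S x = mu • x) (hy : S y = mu • y) : B x y = 0 := by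
  have h1 := h.skew_left x y
  rw [hx, hy] at h1
  simp only [map_smul, LinearMap.smul_apply, smul_eq_mul] at h1
  have h2 : mu * B x y = 0 := by linarith
  exact (mul_eq_zero.1 h2).resolve_left hmu

/-- By coprimality p(-S) is invertible on ker p(S), so `y` has the form p(-S)z, and p(-S) moves
across the form to p(S), which kills `x`. -/
theorem apply_eq_zero_of_aeval_quadraticPoly (h : SkewJordanDecomposition B J S N) {a b : ℝ}
    (ha : a ≠ 0) {x y : V} (hx : aeval S (quadraticPoly a b) x = 0)
    (hy : aeval S (quadraticPoly a b) y = 0) : B x y = 0 := by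
  obtain ⟨u, v, huv⟩ := isCoprime_quadraticPoly_neg (b := b) ha
  have h1 : y = aeval S (quadraticPoly (-a) b) (aeval S v y) := by
    have h2 := congrArg (fun p => aeval S p y) huv
    simp only [map_add, map_mul, LinearMap.add_apply, Module.End.mul_apply, hy, map_zero,
      zero_add, map_one, Module.End.one_apply] at h2
    rw [← Module.End.mul_apply, ← map_mul, mul_comm, map_mul, Module.End.mul_apply]
    exact h2.symm
  rw [h1, ← quadraticPoly_comp_neg, ← Module.End.skew_aeval h.skew_left, hx, map_zero,
    LinearMap.zero_apply]

/-- Expanding p(S + N) gives p(J) = NR on ker p(S), with R = 2S - 2a + N, so p(J)^k x = N^k R^k x.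
On ker N ∩ ker p(S) the operator R = 2(S - a) is injective, because Sz = az and p(S)z = 0 force b²z
= 0; hence R^m N^m x ≠ 0. -/
theorem quadraticPoly_pow_dvd_minpoly [FiniteDimensional ℝ V]
    (h : SkewJordanDecomposition B J S N) {a b : ℝ} (hb : b ≠ 0) {m : ℕ}
    (hm : ∀ v, aeval S (quadraticPoly a b) v = 0 → (N ^ (m + 1)) v = 0) {x : V}
    (hpx : aeval S (quadraticPoly a b) x = 0) (hx : (N ^ m) x ≠ 0) :
    quadraticPoly a b ^ (m + 1) ∣ minpoly ℝ J := by
  set p := quadraticPoly a b with hp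
  set R : Module.End ℝ V := (2 : ℝ) • S - (2 * a) • 1 + N with hR
  have hRapply : ∀ v, R v = (2 : ℝ) • S v - (2 * a) • v + N v := fun v => by
    simp [hR]
  have hSN : Commute S N := LinearMap.ext h.comm
  have hNR : Commute N R :=
    ((hSN.symm.smul_right _).sub_right ((Commute.one_right _).smul_right _)).add_right
      (Commute.refl _)
  have hSR : Commute S R :=
    (((Commute.refl _).smul_right _).sub_right ((Commute.one_right _).smul_right _)).add_right hSN
  have hpR : ∀ k v, aeval S p v = 0 → aeval S p ((R ^ k) v) = 0 := by
    intro k v hv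
    have h1 : Commute R (aeval S p) := Algebra.commute_of_mem_adjoin_singleton_of_commute
      (aeval_mem_adjoin_singleton ℝ S) hSR.symm
    have h2 : aeval S p ((R ^ k) v) = (R ^ k) (aeval S p v) :=
      LinearMap.congr_fun (h1.symm.pow_right k).eq v
    rw [h2, hv, map_zero]
  have hJ : ∀ v, aeval S p v = 0 → aeval J p v = N (R v) := by
    intro v hv
    rw [hp, aeval_quadraticPoly] at hv ⊢
    rw [hRapply, h.eq_add]
    simp only [LinearMap.add_apply, map_add, map_sub, map_smul, ← h.comm]
    linear_combination (norm := module) hv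
  have key : ∀ k, aeval J (p ^ k) x = (N ^ k) ((R ^ k) x) := by
    intro k
    induction k with
    | zero => simp
    | succ k ih =>
      rw [pow_succ', map_mul, Module.End.mul_apply, ih, hJ, pow_succ', Module.End.mul_apply,
        pow_succ' R, Module.End.mul_apply]
      · congr 1
        exact (LinearMap.congr_fun (hNR.pow_left k).eq _).symm
      · rw [h.comm_aeval_pow, hpR k x hpx, map_zero]
  have hRne : ∀ k z, N z = 0 → aeval S p z = 0 → z ≠ 0 → (R ^ k) z ≠ 0 := by
    intro k
    induction k with
    | zero => intro z _ _ hz; simpa using hz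
    | succ k ih =>
      intro z hNz hpz hz
      rw [pow_succ, Module.End.mul_apply]
      refine ih _ ?_ (by simpa using hpR 1 z hpz) fun hRz => hz ?_
      · rw [show N (R z) = R (N z) from LinearMap.congr_fun hNR.eq z, hNz, map_zero]
      · rw [hRapply, hNz, add_zero] at hRz
        have h1 : S z = a • z := by
          linear_combination (norm := module) (1 / 2 : ℝ) • hRz
        rw [hp, aeval_quadraticPoly, h1, map_smul, h1] at hpz
        have h2 : (b ^ 2) • z = 0 := by
          linear_combination (norm := module) hpz
        exact (smul_eq_zero.1 h2).resolve_left (pow_ne_zero 2 hb)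
  refine pow_dvd_minpoly_of_irreducible (x := x) (irreducible_quadraticPoly hb) ?_ ?_
  · rw [key, show (N ^ m) ((R ^ m) x) = (R ^ m) ((N ^ m) x) from
      LinearMap.congr_fun (hNR.pow_pow m m).eq x]
    refine hRne m _ ?_ (by rw [h.comm_aeval_pow, hpx, map_zero]) hx
    rw [← Module.End.mul_apply, ← pow_succ']
    exact hm x hpx
  · rw [key]
    exact hm _ (hpR _ x hpx)

variable [FiniteDimensional ℝ V]

theorem hasBlockFamily_of_pos_eigenvalue (h : SkewJordanDecomposition B J S N) {mu : ℝ}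
    (hmu : 0 < mu) {x₀ : V} (hx₀ : x₀ ≠ 0) (hSx₀ : S x₀ = mu • x₀) : HasBlockFamily B J := by
  have hp : ∀ v, aeval S (X - C mu) v = 0 ↔ S v = mu • v := fun v => by
    simp [Module.algebraMap_end_apply, sub_eq_zero]
  have hp' : ∀ v, aeval S ((X - C mu).comp (-X)) v = 0 ↔ S v = (-mu) • v := fun v => by
    simp [Module.algebraMap_end_apply, sub_eq_zero, neg_eq_iff_eq_neg]
  obtain ⟨m, x, hpx, hx, hm⟩ := h.exists_max_chain (X - C mu) hx₀ ((hp _).2 hSx₀)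
  obtain ⟨y, hpy, hxy⟩ := h.exists_dual_vector_single hpx hx (hm x hpx)
  have hy' := h.pow_eq_zero_on_ker_comp_neg hm hpy
  have hy : (N ^ m) y ≠ 0 := by
    intro h0
    have h1 := LinearMap.BilinForm.skew_pow h.skew_right m x y
    rw [hxy, if_pos rfl, h0, map_zero, mul_zero] at h1
    exact one_ne_zero h1
  have hSx := (hp x).1 hpx
  have hSy := (hp' y).1 hpy
  refine ⟨real mu (m + 1), _, ⟨hmu, Nat.succ_pos m⟩,
    h.isBlockFamily_pair hSx hSy (hm x hpx) hy' hxy (fun k => ?_) (fun k => ?_), ?_⟩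
  · exact h.apply_eq_zero_of_eigenvector hmu.ne' (by rw [h.comm_pow, hSx, map_smul]) hSx
  · exact h.apply_eq_zero_of_eigenvector (neg_ne_zero.2 hmu.ne')
      (by rw [h.comm_pow, hSy, map_smul]) hSy
  · have h1 := h.linear_pow_dvd_minpoly hSx hx (hm x hpx)
    have h2 := h.linear_pow_dvd_minpoly hSy hy hy'
    rw [C_neg, sub_neg_eq_add] at h2
    refine IsCoprime.mul_dvd (IsCoprime.pow ?_) h1 h2
    have h3 := pairwise_coprime_X_sub_C (K := ℝ) Function.injective_id
      (show mu ≠ -mu from fun h => by linarith)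
    simpa [Function.onFun] using h3

/-- The vector `x` gets a companion `v` by Sx = ax - bv. A vector `y` of ker p(-S) dual to both
chains at once then fixes, through its own companion `w`, all remaining products by skewness of `S`.
-/
theorem hasBlockFamily_of_complex_eigenvalue (h : SkewJordanDecomposition B J S N) {a b : ℝ}
    (ha : 0 < a) (hb : 0 < b) {x₀ : V} (hx₀ : x₀ ≠ 0)
    (hpx₀ : aeval S (quadraticPoly a b) x₀ = 0) : HasBlockFamily B J := by
  obtain ⟨m, x, hpx, hx, hm⟩ := h.exists_max_chain _ hx₀ hpx₀
  obtain ⟨v, hbv⟩ : ∃ v : V, b • v = a • x - S x :=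
    ⟨b⁻¹ • (a • x - S x), smul_inv_smul₀ hb.ne' _⟩
  have hSx : S x = a • x - b • v := by rw [hbv]; abel
  have hSv : S v = b • x + a • v := by
    rw [aeval_quadraticPoly] at hpx
    refine smul_right_injective V hb.ne' ?_
    change b • S v = b • (b • x + a • v)
    rw [← map_smul, smul_add, smul_comm b a, hbv, map_sub, map_smul]
    linear_combination (norm := module) -hpx
  have hpv : aeval S (quadraticPoly a b) v = 0 := by
    rw [aeval_quadraticPoly, hSv, map_add, map_smul, map_smul, hSv, hSx]
    module
  let α : (Fin 2 → ℝ) →ₗ[ℝ] V :=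
    (LinearMap.proj 0).smulRight x + (LinearMap.proj 1).smulRight v
  have hα : ∀ f, α f = f 0 • x + f 1 • v := fun f => rfl
  obtain ⟨y, hpy, hxy⟩ := h.exists_dual_vector (p := quadraticPoly a b) (α := α) (m := m)
    (fun f => by rw [hα, map_add, map_smul, map_smul, hpx, hpv]; simp)
    (fun f hf => by
      rw [hα, map_add, map_smul, map_smul] at hf
      -- Applying `S` produces a second, rotated relation; eliminating N^m v from the two leaves
      -- (f₀² + f₁²) N^m x = 0.
      have h1 := congrArg S hf
      rw [map_add, map_smul, map_smul, h.comm_pow, h.comm_pow, hSx, hSv, map_zero, map_add,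
        map_sub, map_smul, map_smul, map_smul, map_smul] at h1
      have h2 : b • (f 1 • (N ^ m) x - f 0 • (N ^ m) v) = 0 := by
        linear_combination (norm := module) h1 - a • hf
      have h3 := (smul_eq_zero.1 h2).resolve_left hb.ne'
      have h4 : (f 0 ^ 2 + f 1 ^ 2) • (N ^ m) x = 0 := by
        linear_combination (norm := module) f 0 • hf + f 1 • h3
      have h5 := (smul_eq_zero.1 h4).resolve_right hx
      have h6 : f 0 = 0 := by nlinarith [sq_nonneg (f 0), sq_nonneg (f 1)]
      have h7 : f 1 = 0 := by nlinarith [sq_nonneg (f 0), sq_nonneg (f 1)]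
      ext i
      fin_cases i
      · exact h6
      · exact h7)
    (fun f => by rw [hα, map_add, map_smul, map_smul, hm x hpx, hm v hpv]; simp)
    (LinearMap.proj 0)
  have hxy0 : ∀ k, B ((N ^ k) x) y = if k = m then 1 else 0 := fun k => by
    simpa [hα] using hxy k ![1, 0]
  have hvy0 : ∀ k, B ((N ^ k) v) y = 0 := fun k => by
    simpa [hα] using hxy k ![0, 1]
  have hm' := fun w (hw : aeval S ((quadraticPoly a b).comp (-X)) w = 0) =>
    h.pow_eq_zero_on_ker_comp_neg hm hw
  rw [quadraticPoly_comp_neg] at hpy hm'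
  obtain ⟨w, hbw⟩ : ∃ w : V, b • w = S y + a • y :=
    ⟨b⁻¹ • (S y + a • y), smul_inv_smul₀ hb.ne' _⟩
  have hSy : S y = (-a) • y + b • w := by rw [hbw]; module
  have hSw : S w = (-b) • y - a • w := by
    have hpy' := hpy
    rw [aeval_quadraticPoly] at hpy'
    refine smul_right_injective V hb.ne' ?_
    change b • S w = b • ((-b) • y - a • w)
    rw [← map_smul, smul_sub, smul_comm b a, hbw, map_add, map_smul]
    linear_combination (norm := module) hpy'
  have hpw : aeval S (quadraticPoly (-a) b) w = 0 := by
    rw [aeval_quadraticPoly, hSw, map_sub, map_smul, map_smul, hSw, hSy]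
    module
  have hBw : ∀ k z, b * B ((N ^ k) z) w = -B ((N ^ k) (S z)) y + a * B ((N ^ k) z) y := by
    intro k z
    rw [← smul_eq_mul, ← map_smul, hbw, map_add, map_smul, ← h.comm_pow, h.skew_left, neg_neg,
      smul_eq_mul]
  have hxw : ∀ k, B ((N ^ k) x) w = 0 := by
    intro k
    have h1 := hBw k x
    rw [hSx, map_sub, map_smul, map_smul] at h1
    simp only [map_sub, map_smul, LinearMap.sub_apply, LinearMap.smul_apply, smul_eq_mul,
      hvy0] at h1
    have h2 : b * B ((N ^ k) x) w = 0 := by rw [h1]; ring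
    exact (mul_eq_zero.1 h2).resolve_left hb.ne'
  have hvw : ∀ k, B ((N ^ k) v) w = if k = m then -1 else 0 := by
    intro k
    have h1 := hBw k v
    rw [hSv, map_add, map_smul, map_smul] at h1
    simp only [map_add, map_smul, LinearMap.add_apply, LinearMap.smul_apply, smul_eq_mul,
      hvy0, hxy0] at h1
    refine mul_left_cancel₀ hb.ne' (h1.trans ?_)
    split_ifs <;> ring
  have hy : (N ^ m) y ≠ 0 := by
    intro h0
    have h1 := LinearMap.BilinForm.skew_pow h.skew_right m x y
    rw [hxy0, if_pos rfl, h0, map_zero, mul_zero] at h1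
    exact one_ne_zero h1
  have hpxs : ∀ s, aeval S (quadraticPoly a b) (![x, v] s) = 0 := by
    intro s
    fin_cases s
    · exact hpx
    · exact hpv
  have hpys : ∀ s, aeval S (quadraticPoly (-a) b) (![y, w] s) = 0 := by
    intro s
    fin_cases s
    · exact hpy
    · exact hpw
  refine ⟨complex a b (m + 1), _, ⟨ha, hb, Nat.succ_pos m⟩,
    h.isBlockFamily_complex (x := ![x, v]) (y := ![y, w]) ?_ ?_ (fun s => hm _ (hpxs s))
      (fun s => hm' _ (hpys s)) ?_ (fun k s t => ?_) (fun k s t => ?_), ?_⟩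
  · intro t
    fin_cases t
    · simp [Fin.sum_univ_two, hSx, sub_eq_add_neg]
    · simp [Fin.sum_univ_two, hSv]
  · intro t
    fin_cases t
    · simp [Fin.sum_univ_two, hSy]
    · simp [Fin.sum_univ_two, hSw, sub_eq_add_neg]
  · intro k s t
    fin_cases s <;> fin_cases t
    · simp [hxy0]
    · simp [hxw]
    · simp [hvy0]
    · simp [hvw]
  · exact h.apply_eq_zero_of_aeval_quadraticPoly ha.ne'
      (by rw [h.comm_aeval_pow, hpxs, map_zero]) (hpxs t)
  · exact h.apply_eq_zero_of_aeval_quadraticPoly (neg_ne_zero.2 ha.ne')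
      (by rw [h.comm_aeval_pow, hpys, map_zero]) (hpys t)
  · have h1 := h.quadraticPoly_pow_dvd_minpoly hb.ne' hm hpx hx
    have h2 := h.quadraticPoly_pow_dvd_minpoly hb.ne' hm' hpy hy
    have h3 := IsCoprime.mul_dvd (isCoprime_quadraticPoly_neg ha.ne').pow h1 h2
    rwa [quadraticPoly_neg] at h3

end SkewJordanDecomposition

/-! ### Normalizing a chain of a selfadjoint operator -/

namespace LinearMap.BilinForm

variable {V : Type*} [AddCommGroup V] [Module ℝ V] {B : LinearMap.BilinForm ℝ V}

theorem selfAdjoint_pow {P : Module.End ℝ V} (hP : ∀ x y, B (P x) y = B x (P y)) (k : ℕ) (x y : V) :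
    B ((P ^ k) x) y = B x ((P ^ k) y) := by
  induction k generalizing x y with
  | zero => simp
  | succ k ih =>
    rw [pow_succ, Module.End.mul_apply, ih, hP, ← Module.End.mul_apply, ← pow_succ', pow_succ]

theorem apply_self_eq_zero_of_skew (hB : ∀ x y, B x y = B y x) {P : Module.End ℝ V}
    (hP : ∀ x y, B (P x) y = -B x (P y)) (x : V) : B (P x) x = 0 := by
  have h1 := hP x x
  rw [hB x (P x)] at h1
  linarith

/-- A vector with `⟨P^m x, x⟩ ≠ 0` for a selfadjoint `P` with `P^(m+1) = 0` can be modified so that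
`⟨P^m x, x⟩ = ±1` and `⟨P^k x, x⟩ = 0` for the other exponents. -/
theorem exists_normalized_chain {P : Module.End ℝ V}
    (hP : ∀ x y, B (P x) y = B x (P y)) {K : Submodule ℝ V} (hPK : ∀ x ∈ K, P x ∈ K) {m : ℕ}
    (hPm : ∀ x ∈ K, (P ^ (m + 1)) x = 0) {x₀ : V} (hx₀ : x₀ ∈ K)
    (hne : B ((P ^ m) x₀) x₀ ≠ 0) :
    ∃ x ∈ K, ∃ ε : ℤˣ, ∀ k, B ((P ^ k) x) x = if k = m then ((ε : ℤ) : ℝ) else 0 := by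
  have hPkK : ∀ k, ∀ x ∈ K, (P ^ k) x ∈ K := by
    intro k
    induction k with
    | zero => intro x hx; simpa using hx
    | succ k ih => intro x hx; rw [pow_succ, Module.End.mul_apply]; exact ih _ (hPK x hx)
  have hzero : ∀ k, m < k → ∀ x ∈ K, (P ^ k) x = 0 := by
    intro k hk x hx
    obtain ⟨l, rfl⟩ := Nat.exists_eq_add_of_lt hk
    rw [show m + l + 1 = (m + 1) + l by ring, pow_add, Module.End.mul_apply]
    exact hPm _ (hPkK l x hx)
  obtain ⟨x₁, hx₁, ε, hε⟩ : ∃ x ∈ K, ∃ ε : ℤˣ, B ((P ^ m) x) x = ((ε : ℤ) : ℝ) := by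
    set β := B ((P ^ m) x₀) x₀ with hβ
    have hs : Real.sqrt |β| ≠ 0 := (Real.sqrt_pos.2 (abs_pos.2 hne)).ne'
    have hss : Real.sqrt |β| * Real.sqrt |β| = |β| := Real.mul_self_sqrt (abs_nonneg β)
    have hcomp : B ((P ^ m) ((Real.sqrt |β|)⁻¹ • x₀)) ((Real.sqrt |β|)⁻¹ • x₀) = β / |β| := by
      simp only [map_smul, LinearMap.smul_apply, smul_eq_mul, ← hβ]
      rw [← mul_assoc, ← mul_inv, hss, inv_mul_eq_div]
    refine ⟨_, K.smul_mem (Real.sqrt |β|)⁻¹ hx₀, ?_⟩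
    rcases lt_or_gt_of_ne hne with hlt | hgt
    · refine ⟨-1, hcomp.trans ?_⟩
      rw [abs_of_neg hlt, div_neg, div_self hne]
      simp
    · refine ⟨1, hcomp.trans ?_⟩
      rw [abs_of_pos hgt, div_self hne]
      simp
  have hεε := CanonicalBlock.coe_units_mul_self ε
  -- The products ⟨P^k x, x⟩ are cleared downwards from k = m - 1; after j rounds those with m - j ≤
  -- k < m vanish.
  have key : ∀ j, ∃ x ∈ K, B ((P ^ m) x) x = ((ε : ℤ) : ℝ) ∧
      ∀ k, k < m → m ≤ k + j → B ((P ^ k) x) x = 0 := by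
    intro j
    induction j with
    | zero => exact ⟨x₁, hx₁, hε, fun k h1 h2 => by omega⟩
    | succ j ih =>
      obtain ⟨x, hx, hxm, hxk⟩ := ih
      -- For k = m - (j + 1), adding c P^(j+1) x changes ⟨P^k x, x⟩ by 2cε, and ε² = 1. Larger
      -- exponents are unaffected, and the term quadratic in c has exponent above m. If j + 1 > m
      -- the correction is zero.
      set c : ℝ := -(((ε : ℤ) : ℝ) * B ((P ^ (m - (j + 1))) x) x) / 2 with hc
      have hexp : ∀ k, m ≤ k + (j + 1) →
          B ((P ^ k) (x + c • (P ^ (j + 1)) x)) (x + c • (P ^ (j + 1)) x) =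
            B ((P ^ k) x) x + 2 * c * B ((P ^ (k + (j + 1))) x) x := by
        intro k hk
        have h1 : (P ^ k) ((P ^ (j + 1)) x) = (P ^ (k + (j + 1))) x := by
          rw [pow_add P k (j + 1), Module.End.mul_apply]
        have h2 : B ((P ^ k) x) ((P ^ (j + 1)) x) = B ((P ^ (k + (j + 1))) x) x := by
          rw [← selfAdjoint_pow hP, ← Module.End.mul_apply, ← pow_add, add_comm]
        have h3 : B ((P ^ (k + (j + 1))) x) ((P ^ (j + 1)) x) = 0 := by
          rw [← selfAdjoint_pow hP, ← Module.End.mul_apply, ← pow_add,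
            hzero _ (by omega) x hx, map_zero, LinearMap.zero_apply]
        simp only [map_add, map_smul, LinearMap.add_apply, LinearMap.smul_apply, smul_eq_mul, h1,
          h2, h3]
        ring
      refine ⟨_, K.add_mem hx (K.smul_mem c (hPkK (j + 1) x hx)), ?_, fun k hk hk' => ?_⟩
      · rw [hexp m (by omega), hzero (m + (j + 1)) (by omega) x hx, hxm]
        simp
      · rw [hexp k hk']
        rcases Nat.lt_or_ge m (k + (j + 1)) with h1 | h1
        · rw [hxk k hk (by omega), hzero _ h1 x hx]
          simp
        · have h2 : k + (j + 1) = m := le_antisymm h1 hk'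
          have h3 : m - (j + 1) = k := by omega
          rw [h2, hxm, hc, h3]
          linear_combination -(B ((P ^ k) x) x) * hεε
  obtain ⟨x, hx, hxm, hxk⟩ := key m
  refine ⟨x, hx, ε, fun k => ?_⟩
  rcases lt_trichotomy k m with h1 | h1 | h1
  · rw [if_neg h1.ne, hxk k h1 (Nat.le_add_left m k)]
  · rw [if_pos h1, h1, hxm]
  · rw [if_neg h1.ne', hzero k h1 x hx, map_zero, LinearMap.zero_apply]

end LinearMap.BilinForm

/-! ### Purely imaginary eigenvalues -/

namespace SkewJordanDecomposition

open CanonicalBlock LinearMap.BilinForm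

variable {V : Type*} [AddCommGroup V] [Module ℝ V] {B : LinearMap.BilinForm ℝ V}
  {J S N : Module.End ℝ V}

theorem apply_pow_self_eq_zero_of_odd (h : SkewJordanDecomposition B J S N) {k : ℕ} (hk : Odd k)
    (x : V) : B ((N ^ k) x) x = 0 :=
  apply_self_eq_zero_of_skew h.symm
    (fun x y => by rw [skew_pow h.skew_right, hk.neg_one_pow, neg_one_mul]) x

theorem isBlockFamily_imaginary (h : SkewJordanDecomposition B J S N) {m : ℕ} {lam : ℝ}
    {x : Fin 2 → V} {ε : ℤˣ} (hSx : ∀ t, S (x t) = ∑ s, !![0, lam; -lam, 0] s t • x s)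
    (hx : ∀ s, (N ^ (m + 1)) (x s) = 0)
    (hxx : ∀ k s t, B ((N ^ k) (x s)) (x t) = if k = m then
      -((ε : ℤ) : ℝ) * (if Odd (m + 1) then !![1, 0; 0, 1] else !![0, -1; 1, 0]) s t else 0) :
    (imaginary lam (m + 1) ε).IsBlockFamily B J
      (fun p : Fin (m + 1) × Fin 2 => (N ^ p.1.val) (x p.2)) := by
  refine ⟨fun p q => ?_, fun q => h.apply_real_chain hSx hx q⟩
  refine (h.gram_chain (fun k => hxx k p.2 q.2) p.1 q.1).trans ?_
  rw [mul_assoc, mul_comm _ (antidiag (m + 1) p.1 q.1)]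
  rfl

theorem isBlockFamily_nilpotentSingle (h : SkewJordanDecomposition B J S N) {m : ℕ} {x : V}
    {ε : ℤˣ} (hSx : S x = 0) (hx : (N ^ (m + 1)) x = 0)
    (hxx : ∀ k, B ((N ^ k) x) x = if k = m then ((ε : ℤ) : ℝ) else 0) :
    (nilpotentSingle (m + 1) ε).IsBlockFamily B J
      (fun i : Fin (m + 1) => (N ^ i.val) x) :=
  ⟨fun i j => h.gram_chain hxx i j,
    fun j => h.apply_chain (mu := 0) (by rw [hSx, zero_smul]) hx j⟩

theorem isBlockFamily_nilpotentPair (h : SkewJordanDecomposition B J S N) {m : ℕ} {x y : V}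
    (hSx : S x = 0) (hSy : S y = 0) (hx : (N ^ (m + 1)) x = 0)
    (hy : (N ^ (m + 1)) y = 0) (hxy : ∀ k, B ((N ^ k) x) y = if k = m then 1 else 0)
    (hxx : ∀ k, B ((N ^ k) x) x = 0) (hyy : ∀ k, B ((N ^ k) y) y = 0) :
    (nilpotentPair (m + 1)).IsBlockFamily B J
      (Sum.elim (fun i : Fin (m + 1) => (N ^ i.val) x) fun i : Fin (m + 1) => (N ^ i.val) y) := by
  have hf := h.isBlockFamily_pair (mu := 0) (by rw [hSx, zero_smul])
    (by rw [hSy, neg_zero, zero_smul]) hx hy hxy hxx hyy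
  have hop : (nilpotentPair (m + 1)).operatorMatrix = (real 0 (m + 1)).operatorMatrix := by
    change Matrix.fromBlocks _ _ _ _ = Matrix.fromBlocks _ _ _ _
    rw [neg_zero]
  exact ⟨hf.gram, fun j => by rw [hop]; exact hf.op j⟩

variable [FiniteDimensional ℝ V]

/-- Polarization: if ⟨Qz, z⟩ vanished on ker p(S), then so would ⟨Qx, y⟩ for all y there, but some
such y, found in ker p(-S), pairs nontrivially with Qx. -/
theorem exists_apply_self_ne_zero (h : SkewJordanDecomposition B J S N) {p : ℝ[X]}
    (hp : ∀ v, aeval S (p.comp (-X)) v = 0 → aeval S p v = 0) {Q : Module.End ℝ V}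
    (hQ : ∀ x y, B (Q x) y = B x (Q y)) {x : V}
    (hpx : aeval S p x = 0) (hpQ : aeval S p (Q x) = 0) (hQx : Q x ≠ 0) :
    ∃ z, aeval S p z = 0 ∧ B (Q z) z ≠ 0 := by
  by_contra! hz
  obtain ⟨φ, hφ⟩ := not_forall.1 (mt (Module.forall_dual_apply_eq_zero_iff ℝ (Q x)).1 hQx)
  obtain ⟨y, hpy, hyv⟩ := h.exists_mem_ker_pairing p φ
  replace hpy := hp y hpy
  have h1 := hz (x + y) (by rw [map_add, hpx, hpy, add_zero])
  have h2 : B (Q y) x = B (Q x) y := by rw [hQ, h.symm]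
  simp only [map_add, LinearMap.add_apply, hz x hpx, hz y hpy, h2] at h1
  exact hφ (by rw [← hyv _ hpQ]; linarith)

/-- Since S² = -λ² on the kernel, λ⁻¹S is a complex structure and P = λ⁻¹SN plays the role of iN: it
is selfadjoint, its even powers are ±N^k and its odd powers ±λ⁻¹SN^k. A chain normalized for `P`
thus controls ⟨N^k x, x⟩ for even k and ⟨SN^k x, x⟩ for odd k; for the other parity these vanish
because N^k or SN^k is skew. -/
theorem hasBlockFamily_of_imaginary_eigenvalue (h : SkewJordanDecomposition B J S N) {lam : ℝ}
    (hlam : 0 < lam) {x₀ : V} (hx₀ : x₀ ≠ 0) (hpx₀ : aeval S (quadraticPoly 0 lam) x₀ = 0) :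
    HasBlockFamily B J := by
  have hp : ∀ v, aeval S (quadraticPoly 0 lam) v = 0 ↔ S (S v) = -(lam ^ 2) • v := fun v => by
    rw [aeval_quadraticPoly, neg_smul, eq_neg_iff_add_eq_zero]
    simp
  have hpneg : (quadraticPoly 0 lam).comp (-X) = quadraticPoly 0 lam := by
    rw [quadraticPoly_comp_neg, neg_zero]
  obtain ⟨m, x₁, hpx₁, hx₁, hm⟩ := h.exists_max_chain _ hx₀ hpx₀
  set P : Module.End ℝ V := lam⁻¹ • (S * N) with hP
  have hPapply : ∀ v, P v = lam⁻¹ • S (N v) := fun v => rfl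
  have hPadj : ∀ x y, B (P x) y = B x (P y) := by
    intro x y
    rw [hPapply, hPapply, map_smul, map_smul, LinearMap.smul_apply, h.skew_left, h.skew_right,
      h.comm, neg_neg]
  have hPS : ∀ v, P (S v) = S (P v) := fun v => by
    rw [hPapply, hPapply, map_smul, ← h.comm v]
  have hPker : ∀ v, aeval S (quadraticPoly 0 lam) v = 0 →
      aeval S (quadraticPoly 0 lam) (P v) = 0 := by
    intro v hv
    rw [hp] at hv ⊢
    rw [← hPS, ← hPS, hv, map_smul]
  have hNker : ∀ v, aeval S (quadraticPoly 0 lam) v = 0 →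
      aeval S (quadraticPoly 0 lam) (N v) = 0 := by
    intro v hv
    have := h.comm_aeval_pow (quadraticPoly 0 lam) 1 v
    rwa [hv, pow_one, map_zero] at this
  have hP2 : ∀ v, aeval S (quadraticPoly 0 lam) v = 0 → P (P v) = -N (N v) := by
    intro v hv
    rw [hPapply, hPapply, map_smul, map_smul, ← h.comm, (hp _).1 (hNker _ (hNker _ hv))]
    rw [smul_smul, smul_smul]
    have : lam⁻¹ * lam⁻¹ * -lam ^ 2 = -1 := by field_simp
    rw [this, neg_one_smul]
  have heven : ∀ l v, aeval S (quadraticPoly 0 lam) v = 0 →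
      (P ^ (2 * l)) v = (-1 : ℝ) ^ l • (N ^ (2 * l)) v := by
    intro l
    induction l with
    | zero => simp
    | succ l ih =>
      intro v hv
      rw [show 2 * (l + 1) = 2 * l + 1 + 1 by ring, pow_succ, pow_succ, Module.End.mul_apply,
        Module.End.mul_apply, hP2 v hv, map_neg, ih _ (hNker _ (hNker _ hv)), pow_succ N,
        pow_succ N, Module.End.mul_apply, Module.End.mul_apply]
      rw [pow_succ]
      module
  have hodd : ∀ l v, aeval S (quadraticPoly 0 lam) v = 0 →
      (P ^ (2 * l + 1)) v = ((-1 : ℝ) ^ l * lam⁻¹) • S ((N ^ (2 * l + 1)) v) := by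
    intro l v hv
    rw [pow_succ, Module.End.mul_apply, heven l _ (hPker v hv), hPapply, map_smul, smul_smul,
      ← h.comm_pow, pow_succ, Module.End.mul_apply]
  have hSinj : ∀ v, aeval S (quadraticPoly 0 lam) v = 0 → S v = 0 → v = 0 := by
    intro v hv hSv
    rw [hp, hSv, map_zero] at hv
    exact (smul_eq_zero.1 hv.symm).resolve_left (neg_ne_zero.2 (pow_ne_zero 2 hlam.ne'))
  have hNkker : ∀ k v, aeval S (quadraticPoly 0 lam) v = 0 →
      aeval S (quadraticPoly 0 lam) ((N ^ k) v) = 0 := fun k v hv => by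
    rw [h.comm_aeval_pow, hv, map_zero]
  have hPzero : ∀ k v, aeval S (quadraticPoly 0 lam) v = 0 → ((P ^ k) v = 0 ↔ (N ^ k) v = 0) := by
    intro k v hv
    obtain ⟨l, rfl | rfl⟩ := k.even_or_odd'
    · rw [heven l v hv, smul_eq_zero]
      simp
    · rw [hodd l v hv, smul_eq_zero]
      constructor
      · rintro (h1 | h1)
        · simp [hlam.ne'] at h1
        · exact hSinj _ (hNkker _ _ hv) h1
      · intro h1
        rw [h1, map_zero]
        exact Or.inr rfl
  have hPkker : ∀ k v, aeval S (quadraticPoly 0 lam) v = 0 →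
      aeval S (quadraticPoly 0 lam) ((P ^ k) v) = 0 := by
    intro k
    induction k with
    | zero => intro v hv; simpa using hv
    | succ k ih => intro v hv; rw [pow_succ, Module.End.mul_apply]; exact ih _ (hPker v hv)
  obtain ⟨x₂, hpx₂, hx₂⟩ := h.exists_apply_self_ne_zero (fun v hv => hpneg ▸ hv)
    (selfAdjoint_pow hPadj m) hpx₁
    (hPkker m _ hpx₁) (mt (hPzero m _ hpx₁).1 hx₁)
  obtain ⟨x, hpx, ε, hxε⟩ := exists_normalized_chain hPadj
    (K := LinearMap.ker (aeval S (quadraticPoly 0 lam))) (m := m) hPker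
    (fun v hv => (hPzero _ v hv).2 (hm v hv)) hpx₂ hx₂
  replace hpx : aeval S (quadraticPoly 0 lam) x = 0 := hpx
  obtain ⟨v, hv⟩ : ∃ v, lam • v = -S x := ⟨lam⁻¹ • (-S x), smul_inv_smul₀ hlam.ne' _⟩
  have hSx : S x = -lam • v := by rw [neg_smul, hv, neg_neg]
  have hSv : S v = lam • x := by
    refine smul_right_injective V hlam.ne' ?_
    change lam • S v = lam • lam • x
    rw [← map_smul, hv, map_neg, (hp x).1 hpx]
    module
  have hpv : aeval S (quadraticPoly 0 lam) v = 0 := by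
    rw [hp, hSv, map_smul, hSx]
    module
  have hxv : ∀ k, B ((N ^ k) x) v = lam⁻¹ * B (S ((N ^ k) x)) x := by
    intro k
    refine mul_left_cancel₀ hlam.ne' ?_
    rw [mul_inv_cancel_left₀ hlam.ne', ← smul_eq_mul, ← map_smul, hv, map_neg, h.skew_left]
  have hvx : ∀ k, B ((N ^ k) v) x = -B ((N ^ k) x) v := by
    intro k
    have h1 : lam * B ((N ^ k) v) x = -B (S ((N ^ k) x)) x := by
      rw [← smul_eq_mul, ← LinearMap.smul_apply, ← map_smul, ← map_smul, hv, map_neg, map_neg,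
        LinearMap.neg_apply, h.comm_pow]
    rw [hxv]
    refine mul_left_cancel₀ hlam.ne' ?_
    rw [h1, mul_neg, mul_inv_cancel_left₀ hlam.ne']
  have hvv : ∀ k, B ((N ^ k) v) v = B ((N ^ k) x) x := by
    intro k
    refine mul_left_cancel₀ hlam.ne' ?_
    rw [← smul_eq_mul, ← map_smul, hv, map_neg, ← h.skew_left, h.comm_pow, hSv, map_smul, map_smul]
    rfl
  have hm_even : ∀ l, m = 2 * l → ∀ k, B ((N ^ k) x) x =
      if k = m then (-1) ^ l * ((ε : ℤ) : ℝ) else 0 := by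
    intro l hl k
    obtain ⟨i, rfl | rfl⟩ := k.even_or_odd'
    · have h1 := hxε (2 * i)
      rw [heven i x hpx, map_smul, LinearMap.smul_apply, smul_eq_mul] at h1
      have h2 : ((-1 : ℝ) ^ i) * (-1) ^ i = 1 := by rw [← mul_pow]; norm_num
      have h3 : B ((N ^ (2 * i)) x) x = (-1) ^ i * if 2 * i = m then ((ε : ℤ) : ℝ) else 0 := by
        rw [← h1, ← mul_assoc, h2, one_mul]
      rw [h3]
      split_ifs with h4
      · rw [show i = l by omega]
      · rw [mul_zero]
    · rw [h.apply_pow_self_eq_zero_of_odd ⟨i, rfl⟩, if_neg (by omega)]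
  have hm_odd : ∀ k, Odd m → B ((N ^ k) x) x = 0 := by
    intro k hmo
    obtain ⟨i, rfl | rfl⟩ := k.even_or_odd'
    · have h1 := hxε (2 * i)
      have h4 : ¬ 2 * i = m := by
        rintro rfl
        exact (Nat.not_odd_iff_even.2 (even_two_mul i)) hmo
      rw [heven i x hpx, map_smul, LinearMap.smul_apply, smul_eq_mul, if_neg h4] at h1
      exact (mul_eq_zero.1 h1).resolve_left (pow_ne_zero _ (by norm_num))
    · exact h.apply_pow_self_eq_zero_of_odd ⟨i, rfl⟩ x
  have hskewS : ∀ i, B (S ((N ^ (2 * i)) x)) x = 0 := by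
    intro i
    refine apply_self_eq_zero_of_skew h.symm (P := S * N ^ (2 * i)) (fun u w => ?_) x
    rw [Module.End.mul_apply, Module.End.mul_apply, h.skew_left, skew_pow h.skew_right,
      (even_two_mul i).neg_one_pow, one_mul, h.comm_pow]
  have hm_odd' : ∀ l, m = 2 * l + 1 → ∀ k, B ((N ^ k) x) v =
      if k = m then (-1) ^ l * ((ε : ℤ) : ℝ) else 0 := by
    intro l hl k
    rw [hxv]
    obtain ⟨i, rfl | rfl⟩ := k.even_or_odd'
    · rw [hskewS, mul_zero, if_neg (by omega)]
    · have h1 := hxε (2 * i + 1)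
      rw [hodd i x hpx, map_smul, LinearMap.smul_apply, smul_eq_mul] at h1
      have h2 : ((-1 : ℝ) ^ i) * (-1) ^ i = 1 := by rw [← mul_pow]; norm_num
      have h3 : lam⁻¹ * B (S ((N ^ (2 * i + 1)) x)) x =
          (-1) ^ i * if 2 * i + 1 = m then ((ε : ℤ) : ℝ) else 0 := by
        rw [← h1]
        linear_combination -(lam⁻¹ * B (S ((N ^ (2 * i + 1)) x)) x) * h2
      rw [h3]
      split_ifs with h4
      · rw [show i = l by omega]
      · rw [mul_zero]
  have hm_even' : ∀ k, Even m → B ((N ^ k) x) v = 0 := by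
    intro k hme
    rw [hxv]
    obtain ⟨i, rfl | rfl⟩ := k.even_or_odd'
    · rw [hskewS, mul_zero]
    · have h1 := hxε (2 * i + 1)
      have h4 : ¬ 2 * i + 1 = m := by
        rintro rfl
        exact (Nat.not_even_iff_odd.2 ⟨i, rfl⟩) hme
      rw [hodd i x hpx, map_smul, LinearMap.smul_apply, smul_eq_mul, if_neg h4, mul_assoc] at h1
      exact (mul_eq_zero.1 h1).resolve_left (pow_ne_zero _ (by norm_num))
  have hpxs : ∀ s, aeval S (quadraticPoly 0 lam) (![x, v] s) = 0 := by
    intro s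
    fin_cases s
    · exact hpx
    · exact hpv
  have hdvd : quadraticPoly 0 lam ^ (m + 1) ∣ minpoly ℝ J :=
    h.quadraticPoly_pow_dvd_minpoly hlam.ne' hm hpx₁ hx₁
  have hpoly : quadraticPoly 0 lam = X ^ 2 + C (lam ^ 2) := by simp [quadraticPoly]
  rw [hpoly] at hdvd
  have hS' : ∀ t, S (![x, v] t) = ∑ s, !![0, lam; -lam, 0] s t • ![x, v] s := by
    intro t
    fin_cases t
    · simp [Fin.sum_univ_two, hSx]
    · simp [Fin.sum_univ_two, hSv]
  obtain ⟨l, hl | hl⟩ := m.even_or_odd'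
  · have hme : Even m := hl ▸ even_two_mul l
    -- The Gram matrix carries minus the sign of the block, so that sign is minus ⟨N^m x, x⟩ =
    -- (-1)^l ε.
    refine ⟨imaginary lam (m + 1) ((-1) ^ (l + 1) * ε), _, ⟨hlam, Nat.succ_pos m⟩,
      h.isBlockFamily_imaginary (x := ![x, v]) hS' (fun s => hm _ (hpxs s)) ?_, hdvd⟩
    intro k s t
    rw [if_pos hme.add_one]
    have hε' : -((((-1) ^ (l + 1) * ε : ℤˣ) : ℤ) : ℝ) = (-1) ^ l * ((ε : ℤ) : ℝ) := by
      push_cast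
      ring
    rw [hε']
    fin_cases s <;> fin_cases t
    · simp [hm_even l hl]
    · simp [hm_even' k hme]
    · simp [hvx, hm_even' k hme]
    · simp [hvv, hm_even l hl]
  · have hmo : Odd m := ⟨l, hl⟩
    -- Here the off-diagonal entry -1 cancels that minus, so the sign of the block is ⟨N^m x, v⟩
    -- itself.
    refine ⟨imaginary lam (m + 1) ((-1) ^ l * ε), _, ⟨hlam, Nat.succ_pos m⟩,
      h.isBlockFamily_imaginary (x := ![x, v]) hS' (fun s => hm _ (hpxs s)) ?_, hdvd⟩
    intro k s t
    rw [if_neg (Nat.not_odd_iff_even.2 hmo.add_one)]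
    have hε' : -((((-1) ^ l * ε : ℤˣ) : ℤ) : ℝ) = -((-1) ^ l * ((ε : ℤ) : ℝ)) := by
      push_cast
      ring
    rw [hε']
    fin_cases s <;> fin_cases t
    · simp [hm_odd k hmo]
    · simp [hm_odd' l hl]
    · refine (hvx k).trans ?_
      rw [hm_odd' l hl]
      split_ifs <;> simp
    · simp [hvv, hm_odd k hmo]

end SkewJordanDecomposition

/-! ### The kernel of `S` -/

namespace SkewJordanDecomposition

open CanonicalBlock LinearMap.BilinForm

variable {V : Type*} [AddCommGroup V] [Module ℝ V] {B : LinearMap.BilinForm ℝ V}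
  {J S N : Module.End ℝ V}

/-- The correction is half a vector `z` in the span of the isotropic chain of `x`, chosen so that
`z` pairs with each N^j y as `y` does. The two cross terms then cancel ⟨N^k y, y⟩, and `z`
contributes nothing with itself or with the chain of `x`. -/
theorem exists_isotropic_dual_chain (h : SkewJordanDecomposition B J S N) {m : ℕ} {x y : V}
    (hSx : S x = 0) (hSy : S y = 0) (hxx : ∀ k, B ((N ^ k) x) x = 0)
    (hxy : ∀ k, B ((N ^ k) x) y = if k = m then 1 else 0) (hm : ∀ v, S v = 0 → (N ^ (m + 1)) v = 0) :
    ∃ y', S y' = 0 ∧ (∀ k, B ((N ^ k) x) y' = if k = m then 1 else 0) ∧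
      ∀ k, B ((N ^ k) y') y' = 0 := by
  have hzero : ∀ k, m < k → (N ^ k) y = 0 := by
    intro k hk
    obtain ⟨l, rfl⟩ := Nat.exists_eq_add_of_lt hk
    rw [show m + l + 1 = l + (m + 1) by ring, pow_add, Module.End.mul_apply, hm y hSy, map_zero]
  have hNxNx : ∀ i j, B ((N ^ i) x) ((N ^ j) x) = 0 := fun i j => by
    rw [skew_pow_apply_pow h.skew_right, hxx, mul_zero]
  -- As ⟨N^(m-k) x, N^j y⟩ is (-1)^j for k = j and 0 otherwise, these coefficients solve ⟨N^j y, z⟩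
  -- = ⟨N^j y, y⟩.
  set z : V := ∑ k ∈ Finset.range (m + 1), ((-1) ^ k * B ((N ^ k) y) y) • (N ^ (m - k)) x with hz
  have hSz : S z = 0 := by
    rw [hz, map_sum]
    refine Finset.sum_eq_zero fun k _ => ?_
    rw [map_smul, h.comm_pow, hSx, map_zero, smul_zero]
  have hxz : ∀ i j, B ((N ^ i) x) ((N ^ j) z) = 0 := by
    intro i j
    rw [hz, map_sum, map_sum]
    refine Finset.sum_eq_zero fun k _ => ?_
    rw [map_smul, map_smul, ← Module.End.mul_apply, ← pow_add, hNxNx, smul_zero]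
  have hzz : ∀ j, B z ((N ^ j) z) = 0 := by
    intro j
    conv_lhs => rw [hz]
    rw [map_sum, LinearMap.sum_apply]
    refine Finset.sum_eq_zero fun k _ => ?_
    rw [map_smul, LinearMap.smul_apply, hxz, smul_zero]
  have hyz : ∀ j, B ((N ^ j) y) z = B ((N ^ j) y) y := by
    intro j
    rcases Nat.lt_or_ge m j with hj | hj
    · rw [hzero j hj, map_zero, LinearMap.zero_apply, LinearMap.zero_apply]
    · have hterm : ∀ k ∈ Finset.range (m + 1),
          B ((N ^ j) y) (((-1) ^ k * B ((N ^ k) y) y) • (N ^ (m - k)) x) =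
            if k = j then B ((N ^ j) y) y else 0 := by
        intro k hk
        have hk' := Finset.mem_range.1 hk
        rw [map_smul, h.symm ((N ^ j) y), skew_pow_apply_pow h.skew_right, hxy, smul_eq_mul]
        by_cases hkj : k = j
        · subst hkj
          have h1 : ((-1 : ℝ) ^ k) * (-1) ^ k = 1 := by rw [← mul_pow]; norm_num
          rw [if_pos (by omega), if_pos rfl]
          linear_combination (B ((N ^ k) y) y) * h1
        · rw [if_neg (by omega), if_neg hkj]
          ring
      rw [hz, map_sum, Finset.sum_congr rfl hterm, Finset.sum_ite_eq',
        if_pos (Finset.mem_range.2 (by omega))]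
  have hzy : ∀ j, B ((N ^ j) z) y = B ((N ^ j) y) y := by
    intro j
    rw [skew_pow h.skew_right, h.symm, hyz]
    rcases Nat.even_or_odd j with hj | hj
    · rw [hj.neg_one_pow, one_mul]
    · rw [h.apply_pow_self_eq_zero_of_odd hj, mul_zero]
  refine ⟨y - (1 / 2 : ℝ) • z, ?_, fun k => ?_, fun k => ?_⟩
  · rw [map_sub, map_smul, hSy, hSz, smul_zero, sub_zero]
  · have h1 := hxz k 0
    rw [pow_zero, Module.End.one_apply] at h1
    rw [map_sub, map_smul, h1, smul_zero, sub_zero, hxy]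
  · have h1 : B ((N ^ k) z) z = 0 := by rw [skew_pow h.skew_right, hzz, mul_zero]
    simp only [map_sub, map_smul, LinearMap.sub_apply, LinearMap.smul_apply, smul_eq_mul, hyz, hzy,
      h1]
    ring

variable [FiniteDimensional ℝ V]

/-- For odd k, ⟨N^k x, x⟩ vanishes by skewness. Even k are cleared downwards: with j = m - k odd, a
multiple of N^j y is added, y being dual to the current x; N^m x does not change because N^(m+j) y =
0. -/
theorem exists_isotropic_chain (h : SkewJordanDecomposition B J S N) {m : ℕ} (hmo : Odd m)
    {x₀ : V} (hSx₀ : S x₀ = 0) (hx₀ : (N ^ m) x₀ ≠ 0) (hm : ∀ v, S v = 0 → (N ^ (m + 1)) v = 0) :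
    ∃ x, S x = 0 ∧ (N ^ m) x ≠ 0 ∧ ∀ k, B ((N ^ k) x) x = 0 := by
  have hzero : ∀ k, m < k → ∀ v, S v = 0 → (N ^ k) v = 0 := by
    intro k hk v hv
    obtain ⟨l, rfl⟩ := Nat.exists_eq_add_of_lt hk
    rw [show m + l + 1 = l + (m + 1) by ring, pow_add, Module.End.mul_apply, hm v hv, map_zero]
  have key : ∀ j, ∃ x, S x = 0 ∧ (N ^ m) x ≠ 0 ∧ ∀ k, m < k + j → B ((N ^ k) x) x = 0 := by
    intro j
    induction j with
    | zero =>
      exact ⟨x₀, hSx₀, hx₀, fun k hk => by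
        rw [hzero k hk _ hSx₀, map_zero, LinearMap.zero_apply]⟩
    | succ j ih =>
      obtain ⟨x, hSx, hx, hxk⟩ := ih
      rcases Nat.even_or_odd j with hj | hj
      · refine ⟨x, hSx, hx, fun k hk => ?_⟩
        rcases Nat.lt_or_ge m (k + j) with h1 | h1
        · exact hxk k h1
        · refine h.apply_pow_self_eq_zero_of_odd ?_ x
          have h2 : k + j = m := by omega
          rw [← h2] at hmo
          exact (Nat.odd_add.1 hmo).2 hj
      · obtain ⟨y, hSy, hxy⟩ := h.exists_dual_vector_single (p := X) (by simpa using hSx) hx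
          (hm x hSx)
        replace hSy : S y = 0 := by simpa using hSy
        have hjpos : 0 < j := hj.pos
        -- Both cross terms equal -c when k = m - j, so c is half the value to be cancelled.
        set c : ℝ := B ((N ^ (m - j)) x) x / 2 with hc
        refine ⟨x + c • (N ^ j) y, ?_, ?_, fun k hk => ?_⟩
        · rw [map_add, map_smul, h.comm_pow, hSx, hSy, map_zero, smul_zero, add_zero]
        · rwa [map_add, map_smul, ← Module.End.mul_apply, ← pow_add, hzero (m + j) (by omega) y hSy,
            smul_zero, add_zero]
        rcases Nat.even_or_odd k with hke | hko
        · have h1 : B ((N ^ k) x) ((N ^ j) y) = -if k + j = m then 1 else 0 := by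
            rw [skew_pow_apply_pow h.skew_right, hxy, hj.neg_one_pow, neg_one_mul]
          have h2 : B ((N ^ k) ((N ^ j) y)) x = -if k + j = m then 1 else 0 := by
            rw [← Module.End.mul_apply, ← pow_add, skew_pow h.skew_right, h.symm, hxy,
              (hke.add_odd hj).neg_one_pow, neg_one_mul]
          have h3 : B ((N ^ k) ((N ^ j) y)) ((N ^ j) y) = 0 := by
            rw [← Module.End.mul_apply, ← pow_add, skew_pow_apply_pow h.skew_right,
              hzero _ (by omega) y hSy, map_zero, LinearMap.zero_apply, mul_zero]
          simp only [map_add, map_smul, LinearMap.add_apply, LinearMap.smul_apply, smul_eq_mul, h1,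
            h2, h3]
          by_cases hkj : k + j = m
          · rw [if_pos hkj, hc, show m - j = k by omega]
            ring
          · rw [if_neg hkj, hxk k (by omega)]
            ring
        · exact h.apply_pow_self_eq_zero_of_odd hko _
  obtain ⟨x, hSx, hx, hxk⟩ := key (m + 1)
  exact ⟨x, hSx, hx, fun k => hxk k (by omega)⟩

/-- The parity of m decides: for even m, N^m is selfadjoint and a single chain can be normalized
through N²; for odd m it is skew and a pair of isotropic dual chains is taken. -/
theorem hasBlockFamily_of_ker_ne_bot (h : SkewJordanDecomposition B J S N) {x₀ : V}
    (hx₀ : x₀ ≠ 0) (hSx₀ : S x₀ = 0) : HasBlockFamily B J := by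
  obtain ⟨m, x₁, hSx₁, hx₁, hm⟩ := h.exists_max_chain X hx₀ (by simpa using hSx₀)
  simp only [aeval_X] at hSx₁ hm
  have hdvd : (X : ℝ[X]) ^ (m + 1) ∣ minpoly ℝ J := by
    have := h.linear_pow_dvd_minpoly (mu := 0) (by rw [hSx₁, zero_smul]) hx₁ (hm x₁ hSx₁)
    rwa [C_0, sub_zero] at this
  obtain ⟨l, rfl | rfl⟩ := m.even_or_odd'
  · have hN2 : ∀ k, (N ^ 2) ^ k = N ^ (2 * k) := fun k => (pow_mul N 2 k).symm
    have hadj : ∀ x y, B ((N ^ 2) x) y = B x ((N ^ 2) y) := fun x y => by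
      rw [skew_pow h.skew_right, even_two.neg_one_pow, one_mul]
    have hker : ∀ k v, S v = 0 → S ((N ^ k) v) = 0 := fun k v hv => by
      rw [h.comm_pow, hv, map_zero]
    have hadj' : ∀ x y, B ((N ^ (2 * l)) x) y = B x ((N ^ (2 * l)) y) := fun x y => by
      rw [skew_pow h.skew_right, (even_two_mul l).neg_one_pow, one_mul]
    obtain ⟨x₂, hSx₂, hx₂⟩ := h.exists_apply_self_ne_zero (p := X) (by simp) hadj'
      (by simpa using hSx₁) (by simpa using hker _ _ hSx₁) hx₁
    rw [aeval_X] at hSx₂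
    obtain ⟨x, hSx, ε, hxε⟩ := exists_normalized_chain hadj (K := LinearMap.ker S) (m := l)
      (hker 2) (fun v hv => by
        rw [hN2, show 2 * (l + 1) = 1 + (2 * l + 1) by ring, pow_add, Module.End.mul_apply,
          hm v hv, map_zero]) hSx₂ (by rwa [hN2])
    refine ⟨nilpotentSingle (2 * l + 1) ε, _, ⟨l, rfl⟩,
      h.isBlockFamily_nilpotentSingle hSx (hm x hSx) fun k => ?_, hdvd⟩
    obtain ⟨i, rfl | rfl⟩ := k.even_or_odd'
    · rw [← hN2, hxε]
      simp
    · rw [h.apply_pow_self_eq_zero_of_odd ⟨i, rfl⟩, if_neg (by omega)]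
  · obtain ⟨x, hSx, hx, hxx⟩ := h.exists_isotropic_chain ⟨l, rfl⟩ hSx₁ hx₁ hm
    obtain ⟨y₁, hSy₁, hxy₁⟩ := h.exists_dual_vector_single (p := X) (by simpa using hSx) hx
      (hm x hSx)
    obtain ⟨y, hSy, hxy, hyy⟩ := h.exists_isotropic_dual_chain hSx (by simpa using hSy₁) hxx hxy₁ hm
    exact ⟨nilpotentPair (2 * l + 1 + 1), _, ⟨⟨l + 1, by ring⟩, Nat.succ_pos _⟩,
      h.isBlockFamily_nilpotentPair hSx hSy (hm x hSx) (hm y hSy) hxy hxx hyy, hdvd⟩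

/-- A complex root of the minimal polynomial of `S` selects the type. A negative real part is made
positive by passing to ker p(-S), which is nonzero by duality. -/
theorem hasBlockFamily [Nontrivial V] (h : SkewJordanDecomposition B J S N) :
    HasBlockFamily B J := by
  have hdeg : (minpoly ℝ S).degree ≠ 0 := (minpoly.degree_pos (Algebra.IsIntegral.isIntegral S)).ne'
  obtain ⟨z, hz⟩ := IsAlgClosed.exists_aeval_eq_zero ℂ (minpoly ℝ S) hdeg
  by_cases him : z.im = 0
  · have hroot : (minpoly ℝ S).IsRoot z.re := by
      have h1 : z = ((z.re : ℝ) : ℂ) := Complex.ext rfl (by simpa using him)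
      rw [h1, ← Complex.coe_algebraMap, aeval_algebraMap_apply] at hz
      simpa using hz
    obtain ⟨x, hx⟩ := (Module.End.hasEigenvalue_of_isRoot hroot).exists_hasEigenvector
    have hSx : S x = z.re • x := hx.apply_eq_smul
    rcases lt_trichotomy z.re 0 with hneg | h0 | hpos
    · obtain ⟨y, hy, hSy⟩ := h.exists_mem_ker_comp_neg_ne_zero (X - C z.re) hx.2
        (by simp [Module.algebraMap_end_apply, hSx])
      refine h.hasBlockFamily_of_pos_eigenvalue (neg_pos.2 hneg) hy ?_
      simpa [Module.algebraMap_end_apply, sub_eq_zero, neg_eq_iff_eq_neg] using hSy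
    · exact h.hasBlockFamily_of_ker_ne_bot hx.2 (by rw [hSx, h0, zero_smul])
    · exact h.hasBlockFamily_of_pos_eigenvalue hpos hx.2 hSx
  · have hb : 0 < |z.im| := abs_pos.2 him
    have hdvd : quadraticPoly z.re |z.im| ∣ minpoly ℝ S := by
      have h1 := quadratic_dvd_of_aeval_eq_zero_im_ne_zero (minpoly ℝ S) hz him
      have h2 : quadraticPoly z.re |z.im| = X ^ 2 - C (2 * z.re) * X + C (‖z‖ ^ 2) := by
        rw [quadraticPoly, sq_abs, Complex.sq_norm, Complex.normSq_apply, ← sq, ← sq]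
      rwa [h2]
    obtain ⟨x, hx, hpx⟩ : ∃ x, x ≠ 0 ∧ aeval S (quadraticPoly z.re |z.im|) x = 0 := by
      -- If the quadratic in `S` were injective, the cofactor `q` would already annihilate `S`,
      -- against minimality of the degree.
      by_contra! hne
      obtain ⟨q, hq⟩ := hdvd
      have hq0 : aeval S q = 0 := by
        ext v
        by_contra hv
        refine hne _ hv ?_
        rw [← Module.End.mul_apply, ← map_mul, ← hq, minpoly.aeval, LinearMap.zero_apply]
      have hqne : q ≠ 0 := by
        rintro rfl
        rw [mul_zero] at hq
        exact minpoly.ne_zero (Algebra.IsIntegral.isIntegral S) hq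
      have h1 := natDegree_le_of_dvd (minpoly.dvd ℝ S hq0) hqne
      rw [hq, natDegree_mul (quadraticPoly_ne_zero _ _) hqne, natDegree_quadraticPoly] at h1
      omega
    rcases lt_trichotomy z.re 0 with hneg | h0 | hpos
    · obtain ⟨y, hy, hpy⟩ := h.exists_mem_ker_comp_neg_ne_zero _ hx hpx
      rw [quadraticPoly_comp_neg] at hpy
      exact h.hasBlockFamily_of_complex_eigenvalue (neg_pos.2 hneg) hb hy hpy
    · rw [h0] at hpx
      exact h.hasBlockFamily_of_imaginary_eigenvalue hb hx hpx
    · exact h.hasBlockFamily_of_complex_eigenvalue hpos hb hx hpx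

end SkewJordanDecomposition

theorem mainTheorem1 {V : Type*} [AddCommGroup V] [Module ℝ V] [FiniteDimensional ℝ V]
    (B : LinearMap.BilinForm ℝ V) (hBsymm : B.IsSymm) (hBnondeg : B.Nondegenerate)
    (J : V →ₗ[ℝ] V) (hJ : B.IsSkewAdjoint J) :
    ∃ (n : ℕ) (W : Fin n → Submodule ℝ V) (c : Fin n → CanonicalBlock),
      DirectSum.IsInternal W ∧
      (∀ i j, i ≠ j → ∀ x ∈ W i, ∀ y ∈ W j, B x y = 0) ∧
      (∀ i, (B.restrict (W i)).Nondegenerate) ∧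
      (∀ i, (c i).Valid ∧ (c i).IsCarriedBy B J (W i)) ∧
      (∀ i, (c i).poly ∣ minpoly ℝ J) := by
  have hsymm : ∀ x y, B x y = B y x := hBsymm.eq
  have hskew : ∀ x y, B (J x) y = -B x (J y) := fun x y => by
    have := hJ x y
    simpa using this
  obtain ⟨n, W, c, hsup, horth, hW⟩ :=
    CanonicalBlock.exists_orthogonal_decomposition_of_exists_block B hsymm J
      (fun U hU hne hnd => by
        have : Nontrivial U := Submodule.nontrivial_iff_ne_bot.2 hne
        obtain ⟨S, N, hadd, hcomm, hS, hN, hskS, hskN⟩ :=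
          Module.End.exists_skew_isSemisimple_isNilpotent (B := B.restrict U)
            (J := J.restrict hU) hnd (fun x y => hskew x y)
        exact SkewJordanDecomposition.hasBlockFamily
          ⟨fun x y => hsymm x y, hnd, hadd, hcomm, hS, hN, hskS, hskN⟩)
      hskew _ ⊤ rfl (fun _ _ => Submodule.mem_top) (by
        refine LinearMap.BilinForm.nondegenerate_of_forall (fun x y => hsymm x y) fun x hx => ?_
        exact Subtype.ext (hBnondeg.1 x fun y => hx ⟨y, Submodule.mem_top⟩))
  have hnd : ∀ i, (B.restrict (W i)).Nondegenerate := by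
    intro i
    obtain ⟨-, -, f, hf, hWf⟩ := hW i
    rw [hWf]
    exact hf.restrict_span_nondegenerate
  refine ⟨n, W, c, LinearMap.BilinForm.isInternal_of_orthogonal_nondegenerate horth hnd hsup, horth,
    hnd, fun i => ⟨(hW i).1, ?_⟩, fun i => (hW i).2.1⟩
  obtain ⟨-, -, f, hf, hWf⟩ := hW i
  rw [hWf]
  exact hf.isCarriedBy_span
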